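/- **Setting.** Let $S\subseteq\mathbb{R}^d$ and let $w^*:\mathbb{R}^d\to S$ be a measurable optimization oracle, $w^*(y)\in\arg\min_{w\in S}y^{\mathrm T}w$ for every $y\in\mathbb{R}^d$. The SPO loss is $\ell_{\mathrm{SPO}}(\hat y,y)=y^{\mathrm T}w^*(\hat y)-y^{\mathrm T}w^*(y)$. Put $\omega_S(y)=\sup_{w\in S}y^{\mathrm T}w-\inf_{w\in S}y^{\mathrm T}w$, and for $\mathfrak{Y}\subseteq\mathbb{R}^d$ put $\omega_S(\mathfrak{Y})=\sup_{y\in\mathfrak{Y}}\omega_S(y)$, assumed finite. Let $(y_i)_{i\ge1}$ be a stationary process of random vectors in $\mathbb{R}^d$ with $y_i\in\mathfrak{Y}$ almost surely. Its mixing coefficients are $$\beta(k)=\sup_n\mathbb{E}\Big[\sup_{A\in\sigma(y_i:\,i\ge n+k)}\big|\mathbb{P}(A\mid y_i,\ i\le n)-\mathbb{P}(A)\big|\Big],\qquad k\ge1,$$ where $\mathbb{P}(\cdot\mid y_i,\ i\le n)$ is the regular conditional law, and the process is assumed to be $\beta$-mixing, i.e. $\beta(k)\to0$ as $k\to\infty$.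 Let $m,a,l\ge1$ be integers with $l<a$ and let $n=2ma+l$. Let $\mathcal{H}$ be a class of measurable functions $f:(\mathbb{R}^d)^l\to\mathbb{R}^d$ (predictors with memory $l$). Define $$R_{\mathrm{SPO},n}(f)=\mathbb{E}\,\ell_{\mathrm{SPO}}(f(y_{n-l},\dots,y_{n-1}),y_n),\qquad \widehat R_{\mathrm{SPO},n}(f)=\frac1{n-l}\sum_{i=l+1}^{n}\ell_{\mathrm{SPO}}(f(y_{i-l},\dots,y_{i-1}),y_i).$$ A window is a pair $z=(x,y)\in(\mathbb{R}^d)^l\times\mathbb{R}^d$; let $\nu$ be the law of the window $((y_1,\dots,y_l),y_{l+1})$. For windows $z_i=(x_i,y_i')$, $i=1,\dots,m$, and i.i.d. Rademacher signs $\sigma_i$ let $$\widehat{\mathfrak R}_{\mathrm{SPO},(z_1,\dots,z_m)}(\mathcal H)=\mathbb{E}_\sigma\Big[\sup_{f\in\mathcal H}\frac1m\sum_{i=1}^m\sigma_i\,\ell_{\mathrm{SPO}}(f(x_i),y_i')\Big],$$ and let $\mathfrak R^{m,\tilde D}_{\mathrm{SPO}}(\mathcal H)$ be its expectation when $z_1,\dots,z_m$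 are i.i.d. with law $\nu$. As usual, suprema over $f\in\mathcal H$ of finite linear combinations of the losses at i.i.d. windows with law $\nu$ are assumed to be measurable (with respect to the completion); this is automatic for countable $\mathcal H$. **Theorem.** Let $\delta_1>2m\beta(a-l)$, $\delta_2>4m\beta(a-l)$, $\delta_1'=\delta_1-2m\beta(a-l)$ and $\delta_2'=\delta_2-2m\beta(a-l)$. 1. With probability at least $1-\delta_1$, for all $f\in\mathcal H$, $$R_{\mathrm{SPO},n}(f)\le\widehat R_{\mathrm{SPO},n}(f)+2\,\mathfrak R^{m,\tilde D}_{\mathrm{SPO}}(\mathcal H)+\omega_S(\mathfrak Y)\sqrt{\frac{\log(2/\delta_1')}{2m}}.$$ 2. For every sample $\tilde{\mathcal Y}$ of $m$ i.i.d. windows with law $\nu$ defined on the same probability space (with any dependence on the data), with probability at least $1-\delta_2$, for all $f\in\mathcal H$, $$R_{\mathrm{SPO},n}(f)\le\widehat R_{\mathrm{SPO},n}(f)+2\,\widehat{\mathfrak R}_{\mathrm{SPO},\tilde{\mathcal Y}}(\mathcal H)+3\,\omega_S(\mathfrak Y)\sqrt{\frac{\log(4/\delta_2')}{2m}}.$$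 For each fixed $j\in\{1,\dots,a\}$ the same holds with $\tilde{\mathcal Y}$ replaced by the $m$ windows $((y_{s},\dots,y_{s+l-1}),y_{s+l})$, $s=2a(i-1)+j$, $i=1,\dots,m$, of the observed data (one from each of $m$ blocks of length $a$, every other block being left out). -/

import Mathlib

open MeasureTheory ProbabilityTheory Filter Topology
open scoped ENNReal

noncomputable section

namespace SPO

/-- The space `ℝ^d` of cost vectors and decisions, with its Euclidean structure. -/
abbrev Vec (d : ℕ) : Type := EuclideanSpace ℝ (Fin d)

/-- `l` consecutive cost vectors (in chronological order) together with the one that follows them: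
the data on which a prediction with memory `l` is made and judged. -/
abbrev Window (d l : ℕ) : Type := (Fin l → Vec d) × Vec d

/-! ### Linear optimization and the SPO loss -/

/-- `wstar` is an optimization oracle for the feasible region `S`: for every cost vector `y` it
returns a minimizer of `w ↦ yᵀ w` over `S`. -/
def IsOracle {d : ℕ} (S : Set (Vec d)) (wstar : Vec d → Vec d) : Prop :=
  ∀ y, wstar y ∈ S ∧ ∀ w ∈ S, inner ℝ y (wstar y) ≤ inner ℝ y w

/-- The SPO loss `yᵀ w*(ŷ) - yᵀ w*(y)` of the prediction `yhat` when `y` is realized. -/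
def spoLoss {d : ℕ} (wstar : Vec d → Vec d) (yhat y : Vec d) : ℝ :=
  inner ℝ y (wstar yhat) - inner ℝ y (wstar y)

/-- The linear optimization gap `ω_S(y) = max_{w ∈ S} yᵀ w - min_{w ∈ S} yᵀ w`. -/
def gapAt {d : ℕ} (S : Set (Vec d)) (y : Vec d) : ℝ :=
  sSup ((fun w => inner ℝ y w) '' S) - sInf ((fun w => inner ℝ y w) '' S)

/-- `ω_S(𝔜) = sup_{y ∈ 𝔜} ω_S(y)`. -/
def gap {d : ℕ} (S : Set (Vec d)) (Y : Set (Vec d)) : ℝ := sSup (gapAt S '' Y)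

/-- The SPO loss of the predictor `f` with memory `l` on a window. -/
def windowLoss {d l : ℕ} (wstar : Vec d → Vec d) (f : (Fin l → Vec d) → Vec d)
    (z : Window d l) : ℝ :=
  spoLoss wstar (f z.1) z.2

/-! ### Stationary and mixing processes

The process `y₁, y₂, …` is indexed from `0`: `y i` is the `(i+1)`-st random vector. -/

section TimeSeries

variable {Ω : Type*} [MeasurableSpace Ω] {d : ℕ}

/-- All blocks of `n + 1` consecutive vectors have the same law. -/
def IsStationary (μ : Measure Ω) (y : ℕ → Ω → Vec d) : Prop :=
  ∀ t n k : ℕ,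
    μ.map (fun ω (j : Fin (n + 1)) => y (t + j) ω) =
      μ.map (fun ω (j : Fin (n + 1)) => y (t + k + j) ω)

/-- The part of the process up to (and including) time `n`. -/
def past (y : ℕ → Ω → Vec d) (n : ℕ) (ω : Ω) : Fin (n + 1) → Vec d := fun j => y j ω

/-- The part of the process from time `n` on. -/
def future (y : ℕ → Ω → Vec d) (n : ℕ) (ω : Ω) : ℕ → Vec d := fun j => y (n + j) ω

/-- The `β`-mixing coefficient
`β(k) = sup_n E [ sup_A | P(A | y_i, i ≤ n) - P(A) | ]`, where `A` runs over the events that are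
determined by `y_i, i ≥ n + k`. The conditional probability is taken as the regular conditional
law of the future given the past, so that the supremum over all `A` makes sense pointwise. -/
def betaCoeff (μ : Measure Ω) [IsFiniteMeasure μ] (y : ℕ → Ω → Vec d) (k : ℕ) : ℝ :=
  (⨆ n : ℕ, ∫⁻ ω, ⨆ A : {A : Set (ℕ → Vec d) // MeasurableSet A},
    ENNReal.ofReal |(condDistrib (future y (n + k)) (past y n) μ (past y n ω)).real A.1
      - (μ.map (future y (n + k))).real A.1| ∂μ).toReal

/-- `β(k) → 0` as `k → ∞`. -/
def IsBetaMixing (μ : Measure Ω) [IsFiniteMeasure μ] (y : ℕ → Ω → Vec d) : Prop :=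
  Tendsto (betaCoeff μ y) atTop (𝓝 0)

/-- The window of the process with entries `y s, …, y (s + l - 1)` and target `y (s + l)`. -/
def windowAt (y : ℕ → Ω → Vec d) (l s : ℕ) (ω : Ω) : Window d l :=
  (fun j => y (s + j) ω, y (s + l) ω)

/-- The law of a window of the (stationary) process. -/
def windowLaw (μ : Measure Ω) (y : ℕ → Ω → Vec d) (l : ℕ) : Measure (Window d l) :=
  μ.map (windowAt y l 0)

/-- The SPO risk `E ℓ_SPO(f(y_{n-l}, …, y_{n-1}), y_n)` (in the numbering from `1`). -/
def risk (μ : Measure Ω) (y : ℕ → Ω → Vec d) (wstar : Vec d → Vec d) (l n : ℕ)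
    (f : (Fin l → Vec d) → Vec d) : ℝ :=
  ∫ ω, windowLoss wstar f (windowAt y l (n - l - 1) ω) ∂μ

/-- The empirical SPO risk of the sample `y₁, …, y_n`: the average of the losses at the targets
`y_{l+1}, …, y_n`. -/
def empRisk (y : ℕ → Ω → Vec d) (wstar : Vec d → Vec d) (l n : ℕ)
    (f : (Fin l → Vec d) → Vec d) (ω : Ω) : ℝ :=
  (1 / ((n - l : ℕ) : ℝ)) * ∑ s ∈ Finset.range (n - l), windowLoss wstar f (windowAt y l s ω)

end TimeSeries

/-! ### Rademacher complexities -/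

/-- The value `±1` of a sign. -/
def signValue (b : Bool) : ℝ := if b then 1 else -1

/-- The empirical Rademacher complexity of `H` with respect to the SPO loss on the windows
`z₁, …, z_m`; the expectation over i.i.d. Rademacher variables is the average over all
sign vectors. -/
def empRademacher {d l : ℕ} (wstar : Vec d → Vec d) (H : Set ((Fin l → Vec d) → Vec d)) {m : ℕ}
    (z : Fin m → Window d l) : ℝ :=
  (1 / (2 : ℝ) ^ m) * ∑ σ : Fin m → Bool,
    ⨆ f : H, (1 / (m : ℝ)) * ∑ i, signValue (σ i) * windowLoss wstar f.1 (z i)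

/-- The law of `m` independent windows with common law `ν`. -/
def iidLaw {d l : ℕ} (ν : Measure (Window d l)) (m : ℕ) : Measure (Fin m → Window d l) :=
  Measure.pi fun _ => ν

/-- The Rademacher complexity of `H` for `m` independent windows with common law `ν`. -/
def iidRademacher {d l : ℕ} (wstar : Vec d → Vec d) (H : Set ((Fin l → Vec d) → Vec d))
    (ν : Measure (Window d l)) (m : ℕ) : ℝ :=
  ∫ z, empRademacher wstar H z ∂(iidLaw ν m)

/-- The loss class of `H` is a `ν`-measurable class: suprema over `H` of linear combinations of
the losses at independent windows are measurable with respect to the completion. It holds for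
instance if `H` is countable. -/
def IsMeasurableClass {d l : ℕ} (wstar : Vec d → Vec d) (H : Set ((Fin l → Vec d) → Vec d))
    (ν : Measure (Window d l)) : Prop :=
  ∀ (k : ℕ) (c : Fin k → ℝ),
    AEMeasurable (fun z : Fin k → Window d l => ⨆ f : H, ∑ i, c i * windowLoss wstar f.1 (z i))
      (iidLaw ν k)

end SPO

end

/-!
The bound rests on the method of independent blocks. The `2 * m * a` windows are divided according
to where they start into `2 * m` blocks of `a` positions. The data behind two blocks of the same
parity are separated by `a - l` time steps, so by mixing the law of the `m` blocks of one parity is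
within `m * β(a - l)` of the law of `m` independent blocks (`SPO.map_blocks_le`), on each event.

For independent blocks, fix a position in the blocks: the windows there are `m` independent windows.
The largest excess of the risk over their average loss is at most the ghost excess, the expectation
over an independent sample of the largest excess of its average loss. Passing to the ghost excess
makes the quantity measurable under the assumption on the class, which speaks of linear combinations
of losses only. Its expectation is at most twice the Rademacher complexity, by symmetrization
(`SPO.BoundedLossClass.integral_ghostExcess_le`). The average of the ghost excesses over the `a`
positions has bounded differences `ω / m` as a function of the blocks, so McDiarmid's inequality
(`SPO.measure_bounded_differences_le`) bounds its deviation, and with it that of the risk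
(`SPO.BoundedLossClass.exists_measurableSet_uniform_deviation_blocks`). The empirical risk is the
mean of the averages for the two parities, which yields the first bound with
`δ₁ = 2 * (δ₁' / 2 + m * β(a - l))`.

The empirical Rademacher complexity has bounded differences `ω / m`, too, and McDiarmid's
inequality lets it replace the Rademacher complexity. Each of the three estimates is used at the
level `δ₂' / 4`. When the complexity is evaluated on the data, it is a function of the blocks of one
parity, hence both estimates for this parity are transferred to the process as a single event, and
the error from mixing remains `2 * m * β(a - l)`.

The SPO loss is bounded by `ω` only at targets in `𝔜`; elsewhere it is replaced by `0`, which
changes it on a null set of windows, simultaneously for all predictors.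
-/

namespace SPO

/-! ### The bounded differences inequality -/

section BoundedDifferences

variable {Z : Type*} [MeasurableSpace Z]

/-- **Hoeffding's lemma** for a function on a probability space whose oscillation is at most `c`. -/
lemma integral_exp_le_of_oscillation_le (ν : Measure Z) [IsProbabilityMeasure ν] {X : Z → ℝ}
    (hX : AEMeasurable X ν) {A c : ℝ} (hA : ∀ x, A ≤ X x) (hc : ∀ x x', X x ≤ X x' + c) (t : ℝ) :
    ∫ x, Real.exp (t * X x) ∂ν ≤ Real.exp (t * ∫ x, X x ∂ν + c ^ 2 * t ^ 2 / 8) := by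
  have hne : Nonempty Z := nonempty_of_isProbabilityMeasure ν
  have hbdd : BddBelow (Set.range X) := ⟨A, by rintro _ ⟨x, rfl⟩; exact hA x⟩
  have hI : ∀ x, X x ∈ Set.Icc (⨅ x, X x) ((⨅ x, X x) + c) := fun x =>
    ⟨ciInf_le hbdd x, by
      have : X x - c ≤ ⨅ x, X x := le_ciInf fun x' => by linarith [hc x x']
      linarith⟩
  have hc0 : 0 ≤ c := by
    obtain ⟨x⟩ := hne
    linarith [hc x x]
  have h := (hasSubgaussianMGF_of_mem_Icc hX (ae_of_all ν hI)).mgf_le t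
  rw [mgf] at h
  have h1 : ∀ x, Real.exp (t * X x)
      = Real.exp (t * ∫ x, X x ∂ν) * Real.exp (t * (X x - ∫ x, X x ∂ν)) := fun x => by
    rw [← Real.exp_add]; ring_nf
  simp_rw [h1]
  rw [integral_const_mul, Real.exp_add]
  refine mul_le_mul_of_nonneg_left (h.trans (le_of_eq ?_)) (Real.exp_pos _).le
  congr 1
  simp only [add_sub_cancel_left, NNReal.coe_pow, NNReal.coe_div, coe_nnnorm, Real.norm_eq_abs,
    abs_of_nonneg hc0, NNReal.coe_ofNat]
  ring

/-- The moment generating function of a function of independent variables with bounded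
differences. Only almost everywhere measurability is assumed, while the differences are bounded
everywhere. The partial integrals are therefore taken as lower integrals, which inherit the bounds
on the differences at every point. -/
lemma integral_exp_le_of_bounded_differences (ν : Measure Z) [IsProbabilityMeasure ν] {c A B : ℝ} :
    ∀ (m : ℕ) (F : (Fin m → Z) → ℝ), AEMeasurable F (Measure.pi fun _ => ν) →
      (∀ z, F z ∈ Set.Icc A B) → (∀ z i x, F (Function.update z i x) ≤ F z + c) → ∀ t : ℝ,
      ∫ z, Real.exp (t * F z) ∂(Measure.pi fun _ => ν)
        ≤ Real.exp (t * ∫ z, F z ∂(Measure.pi fun _ => ν) + m * c ^ 2 * t ^ 2 / 8) := by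
  intro m
  induction m with
  | zero =>
    intro F _ _ _ t
    have h : ∀ z : Fin 0 → Z, z = default := fun z => Subsingleton.elim _ _
    have h1 : ∀ G : (Fin 0 → Z) → ℝ, ∫ z, G z ∂(Measure.pi fun _ => ν) = G default := fun G => by
      simp [h]
    simp [h1]
  | succ m ih =>
    intro F hF hAB hc t
    have e := (measurePreserving_piFinSuccAbove (fun _ : Fin (m + 1) => ν) 0).symm
    set F₂ : Z × (Fin m → Z) → ℝ := fun p => F (Fin.cons p.1 p.2) with hF₂
    have hsymm : ∀ p, (MeasurableEquiv.piFinSuccAbove (fun _ : Fin (m + 1) => Z) 0).symm p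
        = Fin.cons p.1 p.2 := fun p => by
      rcases p with ⟨p1, p2⟩
      simp [MeasurableEquiv.piFinSuccAbove, Fin.insertNthEquiv]
    have hcomp : ∀ g : ℝ → ℝ, ∫ z, g (F z) ∂(Measure.pi fun _ => ν)
        = ∫ p, g (F₂ p) ∂(ν.prod (Measure.pi fun _ => ν)) := fun g => by
      rw [← e.integral_comp']
      simp only [hsymm, hF₂]
    have hF₂m : AEMeasurable F₂ (ν.prod (Measure.pi fun _ => ν)) := by
      have h := hF.comp_quasiMeasurePreserving e.quasiMeasurePreserving
      refine h.congr (ae_of_all _ fun p => ?_)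
      simp only [Function.comp, hsymm, hF₂]
    have hAB₂ : ∀ p, F₂ p ∈ Set.Icc A B := fun p => hAB _
    have hexpm : AEMeasurable (fun p => Real.exp (t * F₂ p)) (ν.prod (Measure.pi fun _ => ν)) :=
      Real.measurable_exp.comp_aemeasurable (hF₂m.const_mul t)
    have hexpI : Integrable (fun p => Real.exp (t * F₂ p)) (ν.prod (Measure.pi fun _ => ν)) := by
      refine integrable_exp_mul_of_mem_Icc (a := A) (b := B) hF₂m (ae_of_all _ hAB₂)
    have hF₂I : Integrable F₂ (ν.prod (Measure.pi fun _ => ν)) :=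
      Integrable.of_mem_Icc A B hF₂m (ae_of_all _ hAB₂)
    -- the lower integral over the first variable
    set F' : (Fin m → Z) → ℝ :=
      fun z => (∫⁻ x, ENNReal.ofReal (F₂ (x, z) - A) ∂ν).toReal + A with hF'
    have hfin : ∀ z, ∫⁻ x, ENNReal.ofReal (F₂ (x, z) - A) ∂ν ≤ ENNReal.ofReal (B - A) := fun z => by
      calc _ ≤ ∫⁻ _, ENNReal.ofReal (B - A) ∂ν :=
            lintegral_mono fun x => ENNReal.ofReal_le_ofReal (by linarith [(hAB₂ (x, z)).2])
        _ = _ := by simp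
    have hswap : AEMeasurable (fun p : (Fin m → Z) × Z => F₂ (p.2, p.1))
        ((Measure.pi fun _ => ν).prod ν) := hF₂m.prod_swap
    have hF'm : AEMeasurable F' (Measure.pi fun _ => ν) := by
      have h : AEMeasurable (fun p : (Fin m → Z) × Z => ENNReal.ofReal (F₂ (p.2, p.1) - A))
        ((Measure.pi fun _ => ν).prod ν) := (hswap.sub_const A).ennreal_ofReal
      exact (h.lintegral_prod_right').ennreal_toReal.add_const A
    have hne : Nonempty Z := nonempty_of_isProbabilityMeasure ν
    have hAleB : A ≤ B := by
      obtain ⟨x⟩ := hne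
      have := hAB (fun _ => x)
      exact this.1.trans this.2
    have hc0 : 0 ≤ c := by
      obtain ⟨x⟩ := hne
      have := hc (fun _ => x) 0 x
      rw [Function.update_eq_self_iff.2 rfl] at this
      linarith
    have hF'AB : ∀ z, F' z ∈ Set.Icc A B := fun z => by
      have h1 := ENNReal.toReal_mono ENNReal.ofReal_ne_top (hfin z)
      rw [ENNReal.toReal_ofReal (by linarith)] at h1
      have h2 : 0 ≤ (∫⁻ x, ENNReal.ofReal (F₂ (x, z) - A) ∂ν).toReal := ENNReal.toReal_nonneg
      exact ⟨by simp only [hF']; linarith, by simp only [hF']; linarith⟩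
    have hF'c : ∀ z i x, F' (Function.update z i x) ≤ F' z + c := fun z i x => by
      have h : ∫⁻ w, ENNReal.ofReal (F₂ (w, Function.update z i x) - A) ∂ν
          ≤ ∫⁻ w, ENNReal.ofReal (F₂ (w, z) - A) ∂ν + ENNReal.ofReal c := by
        calc _ ≤ ∫⁻ w, (ENNReal.ofReal (F₂ (w, z) - A) + ENNReal.ofReal c) ∂ν := by
              refine lintegral_mono fun w => ?_
              rw [← ENNReal.ofReal_add (by linarith [(hAB₂ (w, z)).1]) hc0]
              refine ENNReal.ofReal_le_ofReal ?_
              have := hc (Fin.cons w z) i.succ x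
              rw [← Fin.cons_update] at this
              simp only [hF₂]
              linarith
          _ = _ := by rw [lintegral_add_right _ measurable_const]; simp
      have h1 := ENNReal.toReal_mono
        (ENNReal.add_ne_top.2 ⟨ne_top_of_le_ne_top ENNReal.ofReal_ne_top (hfin z),
          ENNReal.ofReal_ne_top⟩) h
      rw [ENNReal.toReal_add (ne_top_of_le_ne_top ENNReal.ofReal_ne_top (hfin z))
          ENNReal.ofReal_ne_top, ENNReal.toReal_ofReal hc0] at h1
      simp only [hF']
      linarith
    have hslice : ∀ᵐ z ∂(Measure.pi fun _ : Fin m => ν), AEMeasurable (fun x => F₂ (x, z)) ν := by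
      filter_upwards [hswap.aestronglyMeasurable.prodMk_left] with z hz
      exact hz.aemeasurable
    have hF'eq : ∀ᵐ z ∂(Measure.pi fun _ : Fin m => ν), F' z = ∫ x, F₂ (x, z) ∂ν := by
      filter_upwards [hslice] with z hz
      have hI : Integrable (fun x => F₂ (x, z)) ν :=
        Integrable.of_mem_Icc A B hz (ae_of_all _ fun x => hAB₂ (x, z))
      have h1 : ∫ x, (F₂ (x, z) - A) ∂ν = ∫ x, F₂ (x, z) ∂ν - A := by
        rw [integral_sub hI (integrable_const _)]; simp
      rw [integral_eq_lintegral_of_nonneg_ae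
        (ae_of_all _ fun x => by have := (hAB₂ (x, z)).1; simp; linarith)
        (hz.sub_const A).aestronglyMeasurable] at h1
      simp only [hF']
      linarith
    calc ∫ z, Real.exp (t * F z) ∂(Measure.pi fun _ => ν)
        = ∫ p, Real.exp (t * F₂ p) ∂(ν.prod (Measure.pi fun _ => ν)) :=
          hcomp fun u => Real.exp (t * u)
      _ = ∫ z, ∫ x, Real.exp (t * F₂ (x, z)) ∂ν ∂(Measure.pi fun _ => ν) :=
          integral_prod_symm _ hexpI
      _ ≤ ∫ z, Real.exp (c ^ 2 * t ^ 2 / 8) * Real.exp (t * F' z) ∂(Measure.pi fun _ => ν) := by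
          refine integral_mono_ae hexpI.integral_prod_right
            ((integrable_exp_mul_of_mem_Icc (a := A) (b := B) hF'm
              (ae_of_all _ hF'AB)).const_mul _) ?_
          filter_upwards [hslice, hF'eq] with z hz hz'
          rw [hz', ← Real.exp_add, add_comm]
          refine integral_exp_le_of_oscillation_le ν hz (A := A) (fun x => (hAB₂ (x, z)).1)
            (fun x x' => ?_) t
          have := hc (Fin.cons x' z) 0 x
          rwa [Fin.update_cons_zero] at this
      _ = Real.exp (c ^ 2 * t ^ 2 / 8) * ∫ z, Real.exp (t * F' z) ∂(Measure.pi fun _ => ν) :=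
          integral_const_mul _ _
      _ ≤ Real.exp (c ^ 2 * t ^ 2 / 8) * Real.exp (t * ∫ z, F' z ∂(Measure.pi fun _ => ν)
            + m * c ^ 2 * t ^ 2 / 8) :=
          mul_le_mul_of_nonneg_left (ih F' hF'm hF'AB hF'c t) (Real.exp_pos _).le
      _ = _ := by
          rw [hcomp fun u => u, integral_prod_symm _ hF₂I, integral_congr_ae hF'eq, ← Real.exp_add]
          congr 1
          push_cast
          ring

/-- **McDiarmid's inequality**, with the deviation expressed through the confidence level `δ`. -/
theorem measure_bounded_differences_le (ν : Measure Z) [IsProbabilityMeasure ν] {m : ℕ}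
    (hm : 0 < m) {c A B : ℝ} (hc0 : 0 < c) {F : (Fin m → Z) → ℝ}
    (hF : AEMeasurable F (Measure.pi fun _ => ν)) (hAB : ∀ z, F z ∈ Set.Icc A B)
    (hc : ∀ z i x, F (Function.update z i x) ≤ F z + c / m) {δ : ℝ} (hδ : 0 < δ) (hδ1 : δ ≤ 1) :
    (Measure.pi fun _ => ν) {z | ∫ z, F z ∂(Measure.pi fun _ => ν)
      + c * √(Real.log (1 / δ) / (2 * m)) ≤ F z} ≤ ENNReal.ofReal δ := by
  set P : Measure (Fin m → Z) := Measure.pi fun _ => ν with hP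
  have hm' : (0 : ℝ) < m := by exact_mod_cast hm
  set s := √(Real.log (1 / δ) / (2 * m)) with hs
  have hs0 : 0 ≤ s := Real.sqrt_nonneg _
  have hlog : 0 ≤ Real.log (1 / δ) := Real.log_nonneg (by rw [le_div_iff₀ hδ]; linarith)
  have hs2 : s ^ 2 = Real.log (1 / δ) / (2 * m) := Real.sq_sqrt (by positivity)
  -- the minimizer of the Chernoff bound
  set t := 4 * m * s / c with ht
  have ht0 : 0 ≤ t := by positivity
  have h := measure_ge_le_exp_mul_mgf (μ := P) (X := F) (∫ z, F z ∂P + c * s) ht0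
    (integrable_exp_mul_of_mem_Icc (a := A) (b := B) hF (ae_of_all _ hAB))
  have h2 := integral_exp_le_of_bounded_differences ν m F hF hAB hc t
  rw [ENNReal.le_ofReal_iff_toReal_le (measure_ne_top _ _) hδ.le]
  refine h.trans ?_
  calc Real.exp (-t * (∫ z, F z ∂P + c * s)) * mgf F P t
      ≤ Real.exp (-t * (∫ z, F z ∂P + c * s))
        * Real.exp (t * ∫ z, F z ∂P + m * (c / m) ^ 2 * t ^ 2 / 8) :=
        mul_le_mul_of_nonneg_left h2 (Real.exp_pos _).le
    _ = Real.exp (Real.log δ) := by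
        rw [← Real.exp_add]
        congr 1
        have h3 : Real.log δ = -(2 * m * s ^ 2) := by
          rw [hs2, one_div, Real.log_inv]
          field_simp
        rw [h3, ht]
        field_simp
        ring
    _ = δ := Real.exp_log hδ

end BoundedDifferences

/-! ### Suprema of linear combinations of losses -/

/-- The supremum over the class `L` of the linear combination with coefficients `b` of the losses
at the points `z`. -/
noncomputable def supComb {Z ι κ : Type*} [Fintype κ] (L : ι → Z → ℝ) (b : κ → ℝ) (z : κ → Z) : ℝ :=
  ⨆ f, ∑ i, b i * L f (z i)

lemma supComb_comp_equiv {Z ι κ : Type*} [Fintype κ] {L : ι → Z → ℝ} (e : κ ≃ κ)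
    (b : κ → ℝ) (z : κ → Z) :
    supComb L b (z ∘ e) = supComb L (b ∘ e.symm) z := by
  unfold supComb
  congr 1
  ext f
  rw [← e.sum_comp fun i => (b ∘ e.symm) i * L f (z i)]
  simp

section LossClass

variable {Z ι κ : Type*} [MeasurableSpace Z] [Fintype κ]

/-- A family of measurable losses with values in `[0, c]`, such that suprema over the family of
linear combinations of the losses at independent points with law `ν` are measurable with respect
to the completion. -/
structure BoundedLossClass (ν : Measure Z) (L : ι → Z → ℝ) (c : ℝ) : Prop where
  nonneg : ∀ f z, 0 ≤ L f z
  le : ∀ f z, L f z ≤ c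
  measurable : ∀ f, Measurable (L f)
  aemeasurable_iSup : ∀ (k : ℕ) (b : Fin k → ℝ),
    AEMeasurable (fun z : Fin k → Z => ⨆ f, ∑ i, b i * L f (z i)) (Measure.pi fun _ => ν)

/-- The empirical Rademacher complexity of the class `L` at the points `z`. -/
noncomputable def rademacher (L : ι → Z → ℝ) {m : ℕ} (z : Fin m → Z) : ℝ :=
  (1 / (2 : ℝ) ^ m) * ∑ σ : Fin m → Bool, supComb L (fun i => 1 / (m : ℝ) * signValue (σ i)) z

/-- The coefficients of the difference of two averages over `m` points, the second minus the first. -/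
noncomputable def diffCoeff (m : ℕ) : Fin m ⊕ Fin m → ℝ :=
  Sum.elim (fun _ => -(1 / (m : ℝ))) (fun _ => 1 / (m : ℝ))

/-- The expectation over a ghost sample `z'` of `m` independent points with law `ν` of the largest
excess of the average loss on `z'` over the average loss on `z`. It is a lower integral, so that it
is meaningful for every `z`; the constant `2 * c` makes the integrand nonnegative. -/
noncomputable def ghostExcess (ν : Measure Z) (L : ι → Z → ℝ) (c : ℝ) {m : ℕ} (z : Fin m → Z) : ℝ :=
  (∫⁻ z', ENNReal.ofReal (supComb L (diffCoeff m) (Sum.elim z z') + 2 * c)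
    ∂(Measure.pi fun _ : Fin m => ν)).toReal - 2 * c

variable {ν : Measure Z} {L : ι → Z → ℝ} {c : ℝ}

namespace BoundedLossClass

lemma eq_zero (hL : BoundedLossClass ν L 0) : L = fun _ _ => 0 := by
  ext f z
  exact le_antisymm (hL.le f z) (hL.nonneg f z)

lemma integrable [IsProbabilityMeasure ν] (hL : BoundedLossClass ν L c) (f : ι) :
    Integrable (L f) ν :=
  Integrable.of_mem_Icc 0 c (hL.measurable f).aemeasurable
    (ae_of_all _ fun z => ⟨hL.nonneg f z, hL.le f z⟩)

lemma abs_sum_le (hL : BoundedLossClass ν L c) (b : κ → ℝ) (z : κ → Z) (f : ι) :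
    |∑ i, b i * L f (z i)| ≤ (∑ i, |b i|) * c := by
  rw [Finset.sum_mul]
  refine (Finset.abs_sum_le_sum_abs _ _).trans (Finset.sum_le_sum fun i _ => ?_)
  rw [abs_mul, abs_of_nonneg (hL.nonneg f _)]
  exact mul_le_mul_of_nonneg_left (hL.le f _) (abs_nonneg _)

lemma bddAbove (hL : BoundedLossClass ν L c) (b : κ → ℝ) (z : κ → Z) :
    BddAbove (Set.range fun f => ∑ i, b i * L f (z i)) :=
  ⟨(∑ i, |b i|) * c, by
    rintro _ ⟨f, rfl⟩
    exact (abs_le.1 (hL.abs_sum_le b z f)).2⟩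

lemma le_supComb (hL : BoundedLossClass ν L c) (b : κ → ℝ) (z : κ → Z) (f : ι) :
    ∑ i, b i * L f (z i) ≤ supComb L b z :=
  le_ciSup (hL.bddAbove b z) f

lemma supComb_mem_Icc [Nonempty ι] (hL : BoundedLossClass ν L c) (b : κ → ℝ) (z : κ → Z) :
    supComb L b z ∈ Set.Icc (-((∑ i, |b i|) * c)) ((∑ i, |b i|) * c) := by
  obtain ⟨f⟩ := ‹Nonempty ι›
  exact ⟨(abs_le.1 (hL.abs_sum_le b z f)).1.trans (hL.le_supComb b z f),
    ciSup_le fun f => (abs_le.1 (hL.abs_sum_le b z f)).2⟩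

lemma supComb_update_le [Nonempty ι] [DecidableEq κ] (hL : BoundedLossClass ν L c) (b : κ → ℝ)
    (z : κ → Z) (i : κ) (x : Z) :
    supComb L b (Function.update z i x) ≤ supComb L b z + |b i| * c := by
  refine ciSup_le fun f => ?_
  have h1 : ∑ j, b j * L f (Function.update z i x j)
      = ∑ j, b j * L f (z j) + b i * (L f x - L f (z i)) := by
    rw [← sub_eq_iff_eq_add', ← Finset.sum_sub_distrib, Finset.sum_eq_single i]
    · simp; ring
    · intro j _ hj; simp [hj]
    · simp
  have h2 : b i * (L f x - L f (z i)) ≤ |b i| * c := by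
    refine (le_abs_self _).trans ?_
    rw [abs_mul]
    refine mul_le_mul_of_nonneg_left (abs_le.2 ⟨?_, ?_⟩) (abs_nonneg _) <;>
      linarith [hL.nonneg f x, hL.nonneg f (z i), hL.le f x, hL.le f (z i)]
  linarith [hL.le_supComb b z f]

lemma supComb_add_le [Nonempty ι] {κ' : Type*} [Fintype κ'] (hL : BoundedLossClass ν L c)
    (b : κ → ℝ) (b' : κ' → ℝ) (z : κ → Z) (z' : κ' → Z) :
    supComb L (Sum.elim b b') (Sum.elim z z') ≤ supComb L b z + supComb L b' z' := by
  refine ciSup_le fun f => ?_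
  simp only [Fintype.sum_sum_type, Sum.elim_inl, Sum.elim_inr]
  exact add_le_add (hL.le_supComb b z f) (hL.le_supComb b' z' f)

lemma aemeasurable_supComb [IsProbabilityMeasure ν] (hL : BoundedLossClass ν L c) (b : κ → ℝ) :
    AEMeasurable (supComb L b) (Measure.pi fun _ => ν) := by
  have e := measurePreserving_piCongrLeft (fun _ : Fin (Fintype.card κ) => ν) (Fintype.equivFin κ)
  have h := (hL.aemeasurable_iSup _ (b ∘ (Fintype.equivFin κ).symm)).comp_quasiMeasurePreserving
    e.quasiMeasurePreserving
  refine h.congr (ae_of_all _ fun z => ?_)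
  simp only [Function.comp, supComb]
  congr 1
  ext f
  rw [← (Fintype.equivFin κ).sum_comp]
  simp [MeasurableEquiv.coe_piCongrLeft, Equiv.piCongrLeft_apply_apply]

lemma integrable_supComb [IsProbabilityMeasure ν] [Nonempty ι] (hL : BoundedLossClass ν L c)
    (b : κ → ℝ) : Integrable (supComb L b) (Measure.pi fun _ => ν) :=
  Integrable.of_mem_Icc _ _ (hL.aemeasurable_supComb b) (ae_of_all _ fun z => hL.supComb_mem_Icc b z)

end BoundedLossClass

/-! ### Concentration of the empirical Rademacher complexity -/

lemma abs_signValue (b : Bool) : |signValue b| = 1 := by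
  cases b <;> simp [signValue]

lemma abs_signCoeff (m : ℕ) (b : Bool) : |1 / (m : ℝ) * signValue b| = 1 / m := by
  rw [abs_mul, abs_signValue, mul_one, abs_of_nonneg (by positivity)]

lemma average_signs_const (m : ℕ) (r : ℝ) : (1 / (2 : ℝ) ^ m) * ∑ _σ : Fin m → Bool, r = r := by
  simp

lemma average_signs_mono {m : ℕ} {u v : (Fin m → Bool) → ℝ} (h : ∀ σ, u σ ≤ v σ) :
    (1 / (2 : ℝ) ^ m) * ∑ σ, u σ ≤ (1 / (2 : ℝ) ^ m) * ∑ σ, v σ :=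
  mul_le_mul_of_nonneg_left (Finset.sum_le_sum fun σ _ => h σ) (by positivity)

namespace BoundedLossClass

lemma rademacher_mem_Icc [Nonempty ι] {m : ℕ} (hm : 0 < m) (hL : BoundedLossClass ν L c)
    (z : Fin m → Z) : rademacher L z ∈ Set.Icc (-c) c := by
  have hm' : (m : ℝ) ≠ 0 := by positivity
  have h : ∀ σ : Fin m → Bool,
      supComb L (fun i => 1 / (m : ℝ) * signValue (σ i)) z ∈ Set.Icc (-c) c := fun σ => by
    have := hL.supComb_mem_Icc (fun i => 1 / (m : ℝ) * signValue (σ i)) z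
    simp only [abs_signCoeff] at this
    simpa [hm'] using this
  constructor
  · rw [← average_signs_const m (-c)]
    exact average_signs_mono fun σ => (h σ).1
  · rw [← average_signs_const m c]
    exact average_signs_mono fun σ => (h σ).2

lemma rademacher_update_le [Nonempty ι] {m : ℕ} (hL : BoundedLossClass ν L c)
    (z : Fin m → Z) (i : Fin m) (x : Z) :
    rademacher L (Function.update z i x) ≤ rademacher L z + c / m := by
  rw [← average_signs_const m (c / m), rademacher, rademacher, ← mul_add, ← Finset.sum_add_distrib]
  refine average_signs_mono fun σ => ?_
  have := hL.supComb_update_le (fun i => 1 / (m : ℝ) * signValue (σ i)) z i x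
  rwa [abs_signCoeff, one_div_mul_eq_div] at this

lemma aemeasurable_rademacher [IsProbabilityMeasure ν] {m : ℕ} (hL : BoundedLossClass ν L c) :
    AEMeasurable (fun z : Fin m → Z => rademacher L z) (Measure.pi fun _ => ν) := by
  refine AEMeasurable.const_mul ?_ _
  exact Finset.aemeasurable_fun_sum _ fun σ _ => hL.aemeasurable_supComb _

lemma integral_rademacher [IsProbabilityMeasure ν] [Nonempty ι] {m : ℕ}
    (hL : BoundedLossClass ν L c) :
    ∫ z : Fin m → Z, rademacher L z ∂(Measure.pi fun _ => ν)
      = (1 / (2 : ℝ) ^ m) * ∑ σ : Fin m → Bool,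
        ∫ z, supComb L (fun i => 1 / (m : ℝ) * signValue (σ i)) z ∂(Measure.pi fun _ => ν) := by
  unfold rademacher
  rw [integral_const_mul, integral_finsetSum _ fun σ _ => hL.integrable_supComb _]

/-- The lower tail of the empirical Rademacher complexity of an i.i.d. sample. -/
lemma exists_measurableSet_integral_rademacher_le [IsProbabilityMeasure ν] [Nonempty ι] {m : ℕ}
    (hm : 0 < m) (hL : BoundedLossClass ν L c) (hc : 0 ≤ c) {δ : ℝ} (hδ : 0 < δ) (hδ1 : δ ≤ 1) :
    ∃ B : Set (Fin m → Z), MeasurableSet B ∧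
      (Measure.pi fun _ : Fin m => ν) B ≤ ENNReal.ofReal δ ∧
      ∀ z ∉ B, ∫ z : Fin m → Z, rademacher L z ∂(Measure.pi fun _ => ν)
        ≤ rademacher L z + c * √(Real.log (1 / δ) / (2 * m)) := by
  rcases hc.eq_or_lt with rfl | hc
  · have hL0 := hL.eq_zero
    subst hL0
    exact ⟨∅, MeasurableSet.empty, by simp, fun z _ => by simp [rademacher, supComb]⟩
  have h := measure_bounded_differences_le ν hm (A := -c) (B := c) hc
    (F := fun z : Fin m → Z => -rademacher L z)
    hL.aemeasurable_rademacher.neg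
    (fun z => ⟨by have := (hL.rademacher_mem_Icc hm z).2; linarith,
      by have := (hL.rademacher_mem_Icc hm z).1; linarith⟩)
    (fun z i x => by
      have := hL.rademacher_update_le (Function.update z i x) i (z i)
      rw [Function.update_idem, Function.update_eq_self] at this
      linarith) hδ hδ1
  rw [integral_neg] at h
  refine ⟨_, measurableSet_toMeasurable _ _, (measure_toMeasurable _).trans_le h, fun z hz => ?_⟩
  have hz' := not_le.1 fun hh => hz (subset_toMeasurable _ _ (Set.mem_ofPred.2 hh))
  linarith

/-! ### Symmetrization -/

lemma sum_abs_diffCoeff {m : ℕ} (hm : 0 < m) : ∑ i, |diffCoeff m i| = 2 := by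
  have hm' : (m : ℝ) ≠ 0 := by positivity
  simp [diffCoeff, Fintype.sum_sum_type, hm']
  norm_num

lemma supComb_diffCoeff_mem_Icc [Nonempty ι] {m : ℕ} (hm : 0 < m) (hL : BoundedLossClass ν L c)
    (z : Fin m ⊕ Fin m → Z) : supComb L (diffCoeff m) z ∈ Set.Icc (-(2 * c)) (2 * c) := by
  have := hL.supComb_mem_Icc (diffCoeff m) z
  rwa [sum_abs_diffCoeff hm] at this

/-- Exchanging the two samples at the indices where the sign is negative. -/
def signSwap {m : ℕ} (σ : Fin m → Bool) : Fin m ⊕ Fin m ≃ Fin m ⊕ Fin m where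
  toFun := Sum.elim (fun i => if σ i then .inl i else .inr i)
    (fun i => if σ i then .inr i else .inl i)
  invFun := Sum.elim (fun i => if σ i then .inl i else .inr i)
    (fun i => if σ i then .inr i else .inl i)
  left_inv := by rintro (i | i) <;> by_cases h : σ i <;> simp [h]
  right_inv := by rintro (i | i) <;> by_cases h : σ i <;> simp [h]

lemma diffCoeff_comp_signSwap {m : ℕ} (σ : Fin m → Bool) :
    diffCoeff m ∘ (signSwap σ).symm = Sum.elim (fun i => 1 / (m : ℝ) * signValue (!(σ i)))
      (fun i => 1 / (m : ℝ) * signValue (σ i)) := by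
  ext (i | i) <;> by_cases h : σ i <;> simp [signSwap, diffCoeff, signValue, h]

/-- **Symmetrization**: the expected largest difference between the average losses on two
independent samples is at most twice the Rademacher complexity. -/
lemma integral_supComb_diffCoeff_le [IsProbabilityMeasure ν] [Nonempty ι] {m : ℕ}
    (hL : BoundedLossClass ν L c) :
    ∫ z, supComb L (diffCoeff m) z ∂(Measure.pi fun _ => ν)
      ≤ 2 * ∫ z : Fin m → Z, rademacher L z ∂(Measure.pi fun _ => ν) := by
  set J : (Fin m → Bool) → ℝ := fun σ =>
    ∫ z, supComb L (fun i => 1 / (m : ℝ) * signValue (σ i)) z ∂(Measure.pi fun _ => ν) with hJ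
  have hsplit := measurePreserving_sumPiEquivProdPi (fun _ : Fin m ⊕ Fin m => ν)
  have hinl : MeasurePreserving (fun z : Fin m ⊕ Fin m → Z => fun i => z (.inl i))
      (Measure.pi fun _ => ν) (Measure.pi fun _ => ν) := measurePreserving_fst.comp hsplit
  have hinr : MeasurePreserving (fun z : Fin m ⊕ Fin m → Z => fun i => z (.inr i))
      (Measure.pi fun _ => ν) (Measure.pi fun _ => ν) := measurePreserving_snd.comp hsplit
  have key : ∀ σ : Fin m → Bool, ∫ z, supComb L (diffCoeff m) z ∂(Measure.pi fun _ => ν)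
      ≤ J (fun i => !(σ i)) + J σ := fun σ => by
    have e := measurePreserving_piCongrLeft (fun _ : Fin m ⊕ Fin m => ν) (signSwap σ).symm
    have he : ∀ z, MeasurableEquiv.piCongrLeft (fun _ : Fin m ⊕ Fin m => Z) (signSwap σ).symm z
        = z ∘ signSwap σ := fun z => by
      ext i
      obtain ⟨i, rfl⟩ := (signSwap σ).symm.surjective i
      simp [MeasurableEquiv.coe_piCongrLeft, Equiv.piCongrLeft_apply_apply]
    rw [← e.integral_comp']
    simp only [he, supComb_comp_equiv, diffCoeff_comp_signSwap]
    have hl := hinl.integrable_comp_of_integrable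
      (hL.integrable_supComb fun i => 1 / (m : ℝ) * signValue (!(σ i)))
    have hr := hinr.integrable_comp_of_integrable
      (hL.integrable_supComb fun i => 1 / (m : ℝ) * signValue (σ i))
    have e1 := integral_map (μ := Measure.pi fun _ : Fin m ⊕ Fin m => ν)
      hinl.measurable.aemeasurable (f := supComb L fun i => 1 / (m : ℝ) * signValue (!(σ i)))
      (by rw [hinl.map_eq]; exact (hL.aemeasurable_supComb _).aestronglyMeasurable)
    have e2 := integral_map (μ := Measure.pi fun _ : Fin m ⊕ Fin m => ν)
      hinr.measurable.aemeasurable (f := supComb L fun i => 1 / (m : ℝ) * signValue (σ i))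
      (by rw [hinr.map_eq]; exact (hL.aemeasurable_supComb _).aestronglyMeasurable)
    rw [hinl.map_eq] at e1
    rw [hinr.map_eq] at e2
    simp only [hJ]
    rw [e1, e2]
    refine (integral_mono (hL.integrable_supComb _) (hl.add hr) fun z => ?_).trans
      (integral_add hl hr).le
    have := hL.supComb_add_le (fun i => 1 / (m : ℝ) * signValue (!(σ i)))
      (fun i => 1 / (m : ℝ) * signValue (σ i)) (fun i => z (.inl i)) (fun i => z (.inr i))
    rwa [show Sum.elim (fun i => z (.inl i)) (fun i => z (.inr i)) = z by
      ext (i | i) <;> rfl] at this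
  have h1 := average_signs_mono key
  rw [average_signs_const, Finset.sum_add_distrib, mul_add] at h1
  have hnot : ∑ σ : Fin m → Bool, J (fun i => !(σ i)) = ∑ σ, J σ := by
    refine Fintype.sum_bijective (fun (σ : Fin m → Bool) i => !(σ i)) ?_ _ _ fun σ => rfl
    exact Function.Involutive.bijective fun σ => by ext i; simp
  rw [hnot] at h1
  rw [hL.integral_rademacher]
  linarith

/-! ### The ghost sample -/

lemma lintegral_ghost_le [IsProbabilityMeasure ν] [Nonempty ι] {m : ℕ} (hm : 0 < m)
    (hL : BoundedLossClass ν L c) (z : Fin m → Z) :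
    ∫⁻ z', ENNReal.ofReal (supComb L (diffCoeff m) (Sum.elim z z') + 2 * c)
      ∂(Measure.pi fun _ : Fin m => ν) ≤ ENNReal.ofReal (4 * c) := by
  calc _ ≤ ∫⁻ _, ENNReal.ofReal (4 * c) ∂(Measure.pi fun _ : Fin m => ν) :=
        lintegral_mono fun z' => ENNReal.ofReal_le_ofReal
          (by have := (hL.supComb_diffCoeff_mem_Icc hm (Sum.elim z z')).2; linarith)
    _ = _ := by simp

lemma ghostExcess_mem_Icc [IsProbabilityMeasure ν] [Nonempty ι] {m : ℕ} (hm : 0 < m)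
    (hL : BoundedLossClass ν L c) (hc : 0 ≤ c) (z : Fin m → Z) :
    ghostExcess ν L c z ∈ Set.Icc (-(2 * c)) (2 * c) := by
  have h1 := ENNReal.toReal_mono ENNReal.ofReal_ne_top (hL.lintegral_ghost_le hm z)
  rw [ENNReal.toReal_ofReal (by linarith)] at h1
  unfold ghostExcess
  have h2 : 0 ≤ (∫⁻ z', ENNReal.ofReal (supComb L (diffCoeff m) (Sum.elim z z') + 2 * c)
    ∂(Measure.pi fun _ : Fin m => ν)).toReal := ENNReal.toReal_nonneg
  constructor <;> linarith

lemma ghostExcess_update_le [IsProbabilityMeasure ν] [Nonempty ι] {m : ℕ} (hm : 0 < m)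
    (hL : BoundedLossClass ν L c) (hc : 0 ≤ c) (z : Fin m → Z) (i : Fin m) (x : Z) :
    ghostExcess ν L c (Function.update z i x) ≤ ghostExcess ν L c z + c / m := by
  have hcm : 0 ≤ c / m := by positivity
  have h : ∫⁻ z', ENNReal.ofReal (supComb L (diffCoeff m)
        (Sum.elim (Function.update z i x) z') + 2 * c) ∂(Measure.pi fun _ : Fin m => ν)
      ≤ ∫⁻ z', ENNReal.ofReal (supComb L (diffCoeff m) (Sum.elim z z') + 2 * c)
        ∂(Measure.pi fun _ : Fin m => ν) + ENNReal.ofReal (c / m) := by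
    calc _ ≤ ∫⁻ z', (ENNReal.ofReal (supComb L (diffCoeff m) (Sum.elim z z') + 2 * c)
          + ENNReal.ofReal (c / m)) ∂(Measure.pi fun _ : Fin m => ν) := by
          refine lintegral_mono fun z' => ?_
          rw [← ENNReal.ofReal_add (by
            have := (hL.supComb_diffCoeff_mem_Icc hm (Sum.elim z z')).1; linarith) hcm]
          refine ENNReal.ofReal_le_ofReal ?_
          have := hL.supComb_update_le (diffCoeff m) (Sum.elim z z') (.inl i) x
          rw [Sum.update_elim_inl] at this
          have h1 : |diffCoeff m (.inl i)| * c = c / m := by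
            simp [diffCoeff, div_eq_inv_mul]
          linarith
      _ = _ := by rw [lintegral_add_right _ measurable_const]; simp
  have hfin := ne_top_of_le_ne_top ENNReal.ofReal_ne_top (hL.lintegral_ghost_le hm z)
  have h1 := ENNReal.toReal_mono (ENNReal.add_ne_top.2 ⟨hfin, ENNReal.ofReal_ne_top⟩) h
  rw [ENNReal.toReal_add hfin ENNReal.ofReal_ne_top, ENNReal.toReal_ofReal hcm] at h1
  unfold ghostExcess
  linarith

lemma aemeasurable_supComb_elim [IsProbabilityMeasure ν] {m : ℕ} (hL : BoundedLossClass ν L c) :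
    AEMeasurable (fun p : (Fin m → Z) × (Fin m → Z) =>
      supComb L (diffCoeff m) (Sum.elim p.1 p.2))
      ((Measure.pi fun _ => ν).prod (Measure.pi fun _ => ν)) := by
  have e := measurePreserving_sumPiEquivProdPi_symm (fun _ : Fin m ⊕ Fin m => ν)
  refine ((hL.aemeasurable_supComb (diffCoeff m)).comp_quasiMeasurePreserving
    e.quasiMeasurePreserving).congr (ae_of_all _ fun p => ?_)
  simp only [Function.comp]
  congr 1

lemma aemeasurable_ghostExcess [IsProbabilityMeasure ν] {m : ℕ} (hL : BoundedLossClass ν L c) :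
    AEMeasurable (fun z : Fin m → Z => ghostExcess ν L c z) (Measure.pi fun _ => ν) := by
  have h := (hL.aemeasurable_supComb_elim (m := m)).add_const (2 * c)
  exact (h.ennreal_ofReal.lintegral_prod_right').ennreal_toReal.sub_const _

lemma ae_ghostExcess_eq [IsProbabilityMeasure ν] [Nonempty ι] {m : ℕ} (hm : 0 < m)
    (hL : BoundedLossClass ν L c) :
    ∀ᵐ z ∂(Measure.pi fun _ : Fin m => ν),
      Integrable (fun z' => supComb L (diffCoeff m) (Sum.elim z z')) (Measure.pi fun _ => ν) ∧
      ghostExcess ν L c z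
        = ∫ z', supComb L (diffCoeff m) (Sum.elim z z') ∂(Measure.pi fun _ => ν) := by
  filter_upwards [(hL.aemeasurable_supComb_elim (m := m)).aestronglyMeasurable.prodMk_left] with z hz
  have hI : Integrable (fun z' => supComb L (diffCoeff m) (Sum.elim z z'))
      (Measure.pi fun _ => ν) :=
    Integrable.of_mem_Icc _ _ hz.aemeasurable
      (ae_of_all _ fun z' => hL.supComb_diffCoeff_mem_Icc hm _)
  refine ⟨hI, ?_⟩
  have h1 : ∫ z', (supComb L (diffCoeff m) (Sum.elim z z') + 2 * c) ∂(Measure.pi fun _ => ν)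
      = ∫ z', supComb L (diffCoeff m) (Sum.elim z z') ∂(Measure.pi fun _ => ν) + 2 * c := by
    rw [integral_add hI (integrable_const _)]; simp
  rw [integral_eq_lintegral_of_nonneg_ae (ae_of_all _ fun z' => by
      have := (hL.supComb_diffCoeff_mem_Icc hm (Sum.elim z z')).1; simp; linarith)
    (hz.aemeasurable.add_const _).aestronglyMeasurable] at h1
  unfold ghostExcess
  linarith

/-- The expected loss exceeds the average loss on almost every sample by at most the ghost
excess: the expected loss is the expectation of the average loss on the ghost sample. -/
lemma ae_integral_le_add_ghostExcess [IsProbabilityMeasure ν] [Nonempty ι] {m : ℕ} (hm : 0 < m)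
    (hL : BoundedLossClass ν L c) :
    ∀ᵐ z ∂(Measure.pi fun _ : Fin m => ν), ∀ f,
      ∫ x, L f x ∂ν ≤ 1 / (m : ℝ) * ∑ i, L f (z i) + ghostExcess ν L c z := by
  have hm' : (m : ℝ) ≠ 0 := by positivity
  filter_upwards [hL.ae_ghostExcess_eq hm] with z hz f
  have hcoord : ∀ i : Fin m, Integrable (fun z' : Fin m → Z => L f (z' i)) (Measure.pi fun _ => ν) :=
    fun i => (measurePreserving_eval (fun _ : Fin m => ν) i).integrable_comp_of_integrable
      (hL.integrable f)
  have hval : ∀ i : Fin m, ∫ z' : Fin m → Z, L f (z' i) ∂(Measure.pi fun _ => ν)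
      = ∫ x, L f x ∂ν := fun i => by
    have e := measurePreserving_eval (fun _ : Fin m => ν) i
    have := integral_map (μ := Measure.pi fun _ : Fin m => ν) e.measurable.aemeasurable (f := L f)
      (hL.measurable f).aestronglyMeasurable
    rw [e.map_eq] at this
    exact this.symm
  have hsum : Integrable (fun z' : Fin m → Z => ∑ i, 1 / (m : ℝ) * L f (z' i))
      (Measure.pi fun _ => ν) := integrable_finsetSum _ fun i _ => (hcoord i).const_mul _
  have h1 : ∫ z' : Fin m → Z, ∑ i, diffCoeff m i * L f (Sum.elim z z' i) ∂(Measure.pi fun _ => ν)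
      = ∫ x, L f x ∂ν - 1 / (m : ℝ) * ∑ i, L f (z i) := by
    simp only [Fintype.sum_sum_type, Sum.elim_inl, Sum.elim_inr, diffCoeff]
    rw [integral_add (integrable_const _) hsum,
      integral_finsetSum _ fun i _ => (hcoord i).const_mul _]
    simp only [integral_const_mul, hval]
    simp [hm', Finset.mul_sum]
    ring
  have h2 : ∫ z' : Fin m → Z, ∑ i, diffCoeff m i * L f (Sum.elim z z' i) ∂(Measure.pi fun _ => ν)
      ≤ ghostExcess ν L c z := by
    rw [hz.2]
    refine integral_mono ?_ hz.1 fun z' => hL.le_supComb _ _ f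
    simp only [Fintype.sum_sum_type, Sum.elim_inl, Sum.elim_inr, diffCoeff]
    exact (integrable_const _).add hsum
  linarith

lemma integral_ghostExcess_le [IsProbabilityMeasure ν] [Nonempty ι] {m : ℕ} (hm : 0 < m)
    (hL : BoundedLossClass ν L c) :
    ∫ z : Fin m → Z, ghostExcess ν L c z ∂(Measure.pi fun _ => ν)
      ≤ 2 * ∫ z : Fin m → Z, rademacher L z ∂(Measure.pi fun _ => ν) := by
  refine le_trans (le_of_eq ?_) hL.integral_supComb_diffCoeff_le
  have e := measurePreserving_sumPiEquivProdPi_symm (fun _ : Fin m ⊕ Fin m => ν)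
  have he : ∀ p, (MeasurableEquiv.sumPiEquivProdPi fun _ : Fin m ⊕ Fin m => Z).symm p
      = Sum.elim p.1 p.2 := fun p => by ext (i | i) <;> rfl
  rw [integral_congr_ae ((hL.ae_ghostExcess_eq hm).mono fun z hz => hz.2), ← e.integral_comp']
  simp only [he]
  rw [integral_prod]
  exact Integrable.of_mem_Icc _ _ hL.aemeasurable_supComb_elim
      (ae_of_all _ fun p => hL.supComb_diffCoeff_mem_Icc hm _)

/-! ### Uniform deviations over independent blocks -/

/-- A uniform deviation inequality for `m` independent blocks, each of which carries `a` points
with law `ν`, dependent among themselves. For each position in the blocks the `m` points are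
independent, and the average over the positions of the ghost excesses is a function of the blocks
with bounded differences `c / m`. -/
theorem exists_measurableSet_uniform_deviation_blocks {W : Type*} [MeasurableSpace W]
    (P : Measure W) [IsProbabilityMeasure P] [IsProbabilityMeasure ν] [Nonempty ι] {m a : ℕ}
    (hm : 0 < m) (ha : 0 < a) (hL : BoundedLossClass ν L c) (hc : 0 ≤ c)
    {w : Fin a → W → Z} (hw : ∀ r, MeasurePreserving (w r) P ν)
    {δ : ℝ} (hδ : 0 < δ) (hδ1 : δ ≤ 1) :
    ∃ B : Set (Fin m → W), MeasurableSet B ∧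
      (Measure.pi fun _ : Fin m => P) B ≤ ENNReal.ofReal δ ∧
      ∀ b ∉ B, ∀ f, ∫ x, L f x ∂ν ≤ 1 / (a : ℝ) * ∑ r, 1 / (m : ℝ) * ∑ i, L f (w r (b i))
        + 2 * ∫ z : Fin m → Z, rademacher L z ∂(Measure.pi fun _ => ν)
        + c * √(Real.log (1 / δ) / (2 * m)) := by
  rcases hc.eq_or_lt with rfl | hc
  · have hL0 := hL.eq_zero
    subst hL0
    exact ⟨∅, MeasurableSet.empty, by simp, fun b _ f => by simp [rademacher, supComb]⟩
  have ha' : (0 : ℝ) < a := by exact_mod_cast ha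
  have hpos : ∀ r, MeasurePreserving (fun (b : Fin m → W) i => w r (b i))
      (Measure.pi fun _ => P) (Measure.pi fun _ => ν) := fun r =>
    measurePreserving_pi (fun _ => P) (fun _ => ν) fun _ => hw r
  set G : Fin a → (Fin m → W) → ℝ := fun r b => ghostExcess ν L c fun i => w r (b i) with hG
  have hGm : ∀ r, AEMeasurable (G r) (Measure.pi fun _ => P) := fun r =>
    hL.aemeasurable_ghostExcess.comp_quasiMeasurePreserving (hpos r).quasiMeasurePreserving
  have hGI : ∀ r, Integrable (G r) (Measure.pi fun _ => P) := fun r =>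
    Integrable.of_mem_Icc _ _ (hGm r) (ae_of_all _ fun b => hL.ghostExcess_mem_Icc hm hc.le _)
  have havg : ∀ u : ℝ, 1 / (a : ℝ) * ∑ _r : Fin a, u = u := fun u => by
    simp [ha'.ne']
  have hmono : ∀ {u v : Fin a → ℝ}, (∀ r, u r ≤ v r) →
      1 / (a : ℝ) * ∑ r, u r ≤ 1 / (a : ℝ) * ∑ r, v r := fun h =>
    mul_le_mul_of_nonneg_left (Finset.sum_le_sum fun r _ => h r) (by positivity)
  set F : (Fin m → W) → ℝ := fun b => 1 / (a : ℝ) * ∑ r, G r b with hF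
  have hFm : AEMeasurable F (Measure.pi fun _ => P) :=
    (Finset.aemeasurable_fun_sum _ fun r _ => hGm r).const_mul _
  have hFI : ∫ b, F b ∂(Measure.pi fun _ => P)
      ≤ 2 * ∫ z : Fin m → Z, rademacher L z ∂(Measure.pi fun _ => ν) := by
    simp only [hF]
    rw [integral_const_mul, integral_finsetSum _ fun r _ => hGI r, ← havg (2 * _)]
    refine hmono fun r => le_trans (le_of_eq ?_) (hL.integral_ghostExcess_le hm)
    have := integral_map (μ := Measure.pi fun _ : Fin m => P) (hpos r).measurable.aemeasurable
      (f := fun z => ghostExcess ν L c z)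
      (by rw [(hpos r).map_eq]; exact hL.aemeasurable_ghostExcess.aestronglyMeasurable)
    rw [(hpos r).map_eq] at this
    exact this.symm
  have htail := measure_bounded_differences_le P hm (A := -(2 * c)) (B := 2 * c) hc hFm
    (fun b => by
      refine ⟨?_, ?_⟩
      · rw [← havg (-(2 * c))]
        exact hmono fun r => (hL.ghostExcess_mem_Icc hm hc.le _).1
      · rw [← havg (2 * c)]
        exact hmono fun r => (hL.ghostExcess_mem_Icc hm hc.le _).2)
    (fun b i x => by
      simp only [hF]
      rw [← havg (c / m), ← mul_add, ← Finset.sum_add_distrib]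
      refine hmono fun r => ?_
      have := hL.ghostExcess_update_le hm hc.le (fun i => w r (b i)) i (w r x)
      rwa [show Function.update (fun i => w r (b i)) i (w r x)
        = fun j => w r (Function.update b i x j) by
          ext j
          by_cases h : j = i
          · subst h; simp
          · simp [h]] at this) hδ hδ1
  have hae : ∀ᵐ b ∂(Measure.pi fun _ : Fin m => P), ∀ r, ∀ f,
      ∫ x, L f x ∂ν ≤ 1 / (m : ℝ) * ∑ i, L f (w r (b i)) + G r b := by
    rw [ae_all_iff]
    exact fun r => (hpos r).quasiMeasurePreserving.ae (hL.ae_integral_le_add_ghostExcess hm)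
  set B₀ : Set (Fin m → W) := {b | ∫ b, F b ∂(Measure.pi fun _ => P)
    + c * √(Real.log (1 / δ) / (2 * m)) ≤ F b} with hB₀
  set N : Set (Fin m → W) := {b | ¬ ∀ r, ∀ f,
      ∫ x, L f x ∂ν ≤ 1 / (m : ℝ) * ∑ i, L f (w r (b i)) + G r b} with hN
  refine ⟨toMeasurable (Measure.pi fun _ => P) (B₀ ∪ N), measurableSet_toMeasurable _ _, ?_, ?_⟩
  · rw [measure_toMeasurable]
    refine (measure_union_le _ _).trans ?_
    rw [show (Measure.pi fun _ => P) N = 0 from ae_iff.1 hae, add_zero]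
    exact htail
  · intro b hb f
    have hb' := fun hh => hb (subset_toMeasurable _ _ hh)
    have hbF := not_le.1 fun hh => hb' (Or.inl (Set.mem_ofPred.2 hh))
    have hbG := not_not.1 fun hh => hb' (Or.inr (Set.mem_ofPred.2 hh))
    have h1 := hmono fun r => hbG r f
    rw [havg, Finset.sum_add_distrib, mul_add] at h1
    have h2 : F b = 1 / (a : ℝ) * ∑ r, G r b := rfl
    linarith

end BoundedLossClass

end LossClass

/-! ### Mixing and independent blocks -/

section Mixing

variable {Ω : Type*} {d : ℕ}

/-- `N` consecutive vectors of the process, from time `s` on. -/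
def blockAt (y : ℕ → Ω → Vec d) (N s : ℕ) (ω : Ω) : Fin N → Vec d := fun j => y (s + j) ω

/-- The window at position `r` of a block of `a + l` vectors. -/
def blockWindow {a l : ℕ} (r : Fin a) (b : Fin (a + l) → Vec d) : Window d l :=
  (fun j => b ⟨r + j, by omega⟩, b ⟨r + l, by omega⟩)

/-- The blocks of length `a + l` starting at the times `s, s + 2a, …, s + 2a(m - 1)`. -/
def blocks (y : ℕ → Ω → Vec d) (a l m s : ℕ) (ω : Ω) : Fin m → Fin (a + l) → Vec d :=
  fun i => blockAt y (a + l) (s + 2 * a * i) ω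

lemma blockWindow_blockAt (y : ℕ → Ω → Vec d) {a l : ℕ} (r : Fin a) (s : ℕ) (ω : Ω) :
    blockWindow r (blockAt y (a + l) s ω) = windowAt y l (s + r) ω := by
  simp only [blockWindow, blockAt, windowAt, add_assoc]

lemma measurable_blockWindow {a l : ℕ} (r : Fin a) :
    Measurable (blockWindow r : (Fin (a + l) → Vec d) → Window d l) := by
  unfold blockWindow
  fun_prop

variable [MeasurableSpace Ω] {y : ℕ → Ω → Vec d}

lemma measurable_blockAt (hy : ∀ i, Measurable (y i)) (N s : ℕ) : Measurable (blockAt y N s) :=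
  measurable_pi_lambda _ fun _ => hy _

lemma measurable_windowAt (hy : ∀ i, Measurable (y i)) (l s : ℕ) : Measurable (windowAt y l s) :=
  (measurable_pi_lambda _ fun _ => hy _).prodMk (hy _)

lemma measurable_blocks (hy : ∀ i, Measurable (y i)) (a l m s : ℕ) :
    Measurable (blocks y a l m s) :=
  measurable_pi_lambda _ fun _ => measurable_blockAt hy _ _

variable {μ : Measure Ω}

lemma IsStationary.map_blockAt (h : IsStationary μ y) (N s : ℕ) :
    μ.map (blockAt y N s) = μ.map (blockAt y N 0) := by
  rcases N with _ | N
  · congr 1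
    ext ω i
    exact i.elim0
  · have := h 0 N s
    rw [zero_add] at this
    exact this.symm

lemma IsStationary.map_windowAt (h : IsStationary μ y) (hy : ∀ i, Measurable (y i)) (l s : ℕ) :
    μ.map (windowAt y l s) = windowLaw μ y l := by
  have h1 : ∀ s, windowAt y l s = blockWindow (0 : Fin 1) ∘ blockAt y (1 + l) s := fun s => by
    ext1 ω
    exact (blockWindow_blockAt y (0 : Fin 1) s ω).symm
  rw [windowLaw, h1 s, h1 0, ← Measure.map_map (measurable_blockWindow _) (measurable_blockAt hy _ _),
    ← Measure.map_map (measurable_blockWindow _) (measurable_blockAt hy _ _), h.map_blockAt]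

lemma IsStationary.measurePreserving_blockWindow (h : IsStationary μ y)
    (hy : ∀ i, Measurable (y i)) {a l : ℕ} (r : Fin a) :
    MeasurePreserving (blockWindow r) (μ.map (blockAt y (a + l) 0)) (windowLaw μ y l) := by
  refine ⟨measurable_blockWindow r, ?_⟩
  rw [Measure.map_map (measurable_blockWindow _) (measurable_blockAt hy _ _),
    ← h.map_windowAt hy l (0 + r)]
  congr 1
  ext1 ω
  exact blockWindow_blockAt y r 0 ω

variable [IsProbabilityMeasure μ]

lemma lintegral_iSup_le_betaCoeff (hy : ∀ i, Measurable (y i)) (n k : ℕ) :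
    ∫⁻ ω, ⨆ A : {A : Set (ℕ → Vec d) // MeasurableSet A},
      ENNReal.ofReal |(condDistrib (future y (n + k)) (past y n) μ (past y n ω)).real A.1
        - (μ.map (future y (n + k))).real A.1| ∂μ ≤ ENNReal.ofReal (betaCoeff μ y k) := by
  have hfut : ∀ n, Measurable (future y n) := fun n => measurable_pi_lambda _ fun _ => hy _
  rw [betaCoeff, ENNReal.ofReal_toReal]
  · exact le_iSup (fun n => ∫⁻ ω, ⨆ A : {A : Set (ℕ → Vec d) // MeasurableSet A},
      ENNReal.ofReal |(condDistrib (future y (n + k)) (past y n) μ (past y n ω)).real A.1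
        - (μ.map (future y (n + k))).real A.1| ∂μ) n
  · refine ne_top_of_le_ne_top ENNReal.one_ne_top (iSup_le fun n => ?_)
    have := Measure.isProbabilityMeasure_map (μ := μ) (hfut (n + k)).aemeasurable
    calc _ ≤ ∫⁻ _, 1 ∂μ := lintegral_mono fun ω => iSup_le fun A => by
          rw [ENNReal.ofReal_le_one, abs_le]
          constructor <;> linarith [measureReal_nonneg (s := A.1)
            (μ := condDistrib (future y (n + k)) (past y n) μ (past y n ω)),
            measureReal_le_one (s := A.1)
              (μ := condDistrib (future y (n + k)) (past y n) μ (past y n ω)),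
            measureReal_nonneg (s := A.1) (μ := μ.map (future y (n + k))),
            measureReal_le_one (s := A.1) (μ := μ.map (future y (n + k)))]
      _ = 1 := by simp

/-- Past and future, `k` steps apart, are independent up to an error `β(k)` in total variation:
the conditional law of the future is compared with its law on each section of the event. -/
lemma map_past_future_le (hy : ∀ i, Measurable (y i)) (n k : ℕ)
    {B : Set ((Fin (n + 1) → Vec d) × (ℕ → Vec d))} (hB : MeasurableSet B) :
    μ.map (fun ω => (past y n ω, future y (n + k) ω)) B
      ≤ ((μ.map (past y n)).prod (μ.map (future y (n + k)))) B
        + ENNReal.ofReal (betaCoeff μ y k) := by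
  have hpast : Measurable (past y n) := measurable_pi_lambda _ fun _ => hy _
  have hfut : Measurable (future y (n + k)) := measurable_pi_lambda _ fun _ => hy _
  have := Measure.isProbabilityMeasure_map (μ := μ) hfut.aemeasurable
  rw [← compProd_map_condDistrib hfut.aemeasurable, Measure.compProd_apply hB,
    Measure.prod_apply hB, lintegral_map (Kernel.measurable_kernel_prodMk_left hB) hpast,
    lintegral_map (measurable_measure_prodMk_left hB) hpast]
  refine le_trans ?_ (add_le_add_right (lintegral_iSup_le_betaCoeff hy n k) _)
  have hsec : Measurable fun ω => μ.map (future y (n + k)) (Prod.mk (past y n ω) ⁻¹' B) :=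
    (measurable_measure_prodMk_left hB).comp hpast
  rw [← lintegral_add_left hsec]
  refine lintegral_mono fun ω => ?_
  have hA : MeasurableSet (Prod.mk (past y n ω) ⁻¹' B) := measurable_prodMk_left hB
  refine le_trans ?_ (add_le_add_right (le_iSup
    (fun A : {A : Set (ℕ → Vec d) // MeasurableSet A} =>
      ENNReal.ofReal |(condDistrib (future y (n + k)) (past y n) μ (past y n ω)).real A.1
        - (μ.map (future y (n + k))).real A.1|) ⟨_, hA⟩) _)
  rw [← ofReal_measureReal (μ := condDistrib (future y (n + k)) (past y n) μ (past y n ω)),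
    ← ofReal_measureReal (μ := μ.map (future y (n + k))),
    ← ENNReal.ofReal_add measureReal_nonneg (abs_nonneg _)]
  refine ENNReal.ofReal_le_ofReal ?_
  linarith [le_abs_self ((condDistrib (future y (n + k)) (past y n) μ (past y n ω)).real
    (Prod.mk (past y n ω) ⁻¹' B) - (μ.map (future y (n + k))).real (Prod.mk (past y n ω) ⁻¹' B))]

lemma map_prodMk_le_of_past_future {α γ : Type*} [MeasurableSpace α] [MeasurableSpace γ]
    (hy : ∀ i, Measurable (y i)) (n k : ℕ) {g : (Fin (n + 1) → Vec d) → α} (hg : Measurable g)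
    {h : (ℕ → Vec d) → γ} (hh : Measurable h) {B : Set (γ × α)} (hB : MeasurableSet B) :
    μ.map (fun ω => (h (future y (n + k) ω), g (past y n ω))) B
      ≤ ((μ.map fun ω => h (future y (n + k) ω)).prod (μ.map fun ω => g (past y n ω))) B
        + ENNReal.ofReal (betaCoeff μ y k) := by
  have hpast : Measurable (past y n) := measurable_pi_lambda _ fun _ => hy _
  have hfut : Measurable (future y (n + k)) := measurable_pi_lambda _ fun _ => hy _
  have hB' : MeasurableSet (Prod.map g h ⁻¹' (Prod.swap ⁻¹' B)) :=
    (hg.prodMap hh) (measurable_swap hB)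
  have := map_past_future_le (μ := μ) hy n k hB'
  rw [Measure.map_apply (hpast.prodMk hfut) hB',
    ← Measure.map_apply (hg.prodMap hh) (measurable_swap hB),
    ← Measure.map_prod_map _ _ hg hh, Measure.map_map hg hpast, Measure.map_map hh hfut,
    ← Measure.map_apply measurable_swap hB, Measure.prod_swap] at this
  have hpair : Measurable fun ω => (h (future y (n + k) ω), g (past y n ω)) :=
    (hh.comp hfut).prodMk (hg.comp hpast)
  rw [Measure.map_apply hpair hB]
  exact this

/-- **Independent blocks**: blocks which are separated by `a - l` time steps are independent with
a common law up to an error `m * β(a - l)` in total variation. -/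
theorem map_blocks_le (hy : ∀ i, Measurable (y i)) (hstat : IsStationary μ y) {a l : ℕ}
    (hla : l < a) (s : ℕ) : ∀ (m : ℕ) {B : Set (Fin m → Fin (a + l) → Vec d)}, MeasurableSet B →
      μ.map (blocks y a l m s) B ≤ (Measure.pi fun _ => μ.map (blockAt y (a + l) 0)) B
        + ENNReal.ofReal (m * betaCoeff μ y (a - l)) := by
  set P := μ.map (blockAt y (a + l) 0) with hP
  have hPp : IsProbabilityMeasure P :=
    Measure.isProbabilityMeasure_map (measurable_blockAt hy _ _).aemeasurable
  have hβ : 0 ≤ betaCoeff μ y (a - l) := ENNReal.toReal_nonneg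
  intro m
  induction m with
  | zero =>
    intro B hB
    have : μ.map (blocks y a l 0 s) = Measure.pi fun _ => P := by
      have := Measure.isProbabilityMeasure_map (μ := μ) (measurable_blocks hy a l 0 s).aemeasurable
      ext C hC
      rcases Set.eq_empty_or_nonempty C with rfl | hne
      · simp
      · rw [Set.Nonempty.eq_univ hne]
        simp
    rw [this]
    exact le_self_add
  | succ m ih =>
    intro B hB
    set e := MeasurableEquiv.piFinSuccAbove (fun _ : Fin (m + 1) => Fin (a + l) → Vec d)
      (Fin.last m) with he
    have hpres := measurePreserving_piFinSuccAbove (fun _ : Fin (m + 1) => P) (Fin.last m)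
    have hB' : MeasurableSet (e.symm ⁻¹' B) := e.symm.measurable hB
    have hlast : Measurable (blockAt y (a + l) (s + 2 * a * m)) := measurable_blockAt hy _ _
    have hsplit : μ.map (blocks y a l (m + 1) s) B
        = μ.map (fun ω => (blockAt y (a + l) (s + 2 * a * m) ω, blocks y a l m s ω))
          (e.symm ⁻¹' B) := by
      rw [Measure.map_apply (measurable_blocks hy _ _ _ _) hB,
        Measure.map_apply (hlast.prodMk (measurable_blocks hy _ _ _ _)) hB']
      congr 1
      ext ω
      rw [Set.mem_preimage, Set.mem_preimage, Set.mem_preimage]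
      have : (blockAt y (a + l) (s + 2 * a * m) ω, blocks y a l m s ω)
          = e (blocks y a l (m + 1) s ω) := by
        ext1
        · simp [he, MeasurableEquiv.piFinSuccAbove, Fin.insertNthEquiv, blocks]
        · ext1 i
          simp [he, MeasurableEquiv.piFinSuccAbove, Fin.insertNthEquiv, blocks, Fin.init]
      rw [this, MeasurableEquiv.symm_apply_apply]
    have hpi : (Measure.pi fun _ : Fin (m + 1) => P) B
        = (P.prod (Measure.pi fun _ : Fin m => P)) (e.symm ⁻¹' B) :=
      (hpres.symm.measure_preimage_equiv B).symm
    -- the new block is nearly independent of the previous ones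
    have hstep : μ.map (fun ω => (blockAt y (a + l) (s + 2 * a * m) ω, blocks y a l m s ω))
          (e.symm ⁻¹' B)
        ≤ (P.prod (μ.map (blocks y a l m s))) (e.symm ⁻¹' B)
          + ENNReal.ofReal (betaCoeff μ y (a - l)) := by
      rw [← hstat.map_blockAt (a + l) (s + 2 * a * m)] at hP
      rw [hP]
      rcases Nat.eq_zero_or_pos m with rfl | hm
      · -- without previous blocks, independence is trivial
        refine le_trans (le_of_eq ?_) le_self_add
        rw [Measure.prod_apply_symm hB', lintegral_map (measurable_measure_prodMk_right hB')
          (measurable_blocks hy _ _ _ _), Measure.map_apply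
            (hlast.prodMk (measurable_blocks hy _ _ _ _)) hB']
        have h0 : ∀ ω, blocks y a l 0 s ω = default := fun ω => Subsingleton.elim _ _
        simp only [h0, lintegral_const, measure_univ, mul_one]
        rw [Measure.map_apply hlast (measurable_prodMk_right hB')]
        rfl
      · -- the previous blocks end `a - l` steps before the new one starts
        obtain ⟨q, rfl⟩ : ∃ q, m = q + 1 := ⟨m - 1, by omega⟩
        set n := s + 2 * a * (q + 1) - (a - l) with hn
        have hexp : 2 * a * (q + 1) = 2 * a * q + 2 * a := by ring
        have hn' : n + (a - l) = s + 2 * a * (q + 1) := by omega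
        have hidx : ∀ (i : Fin (q + 1)) (j : Fin (a + l)), s + 2 * a * i + j < n + 1 := by
          intro i j
          have h1 : 2 * a * (i : ℕ) ≤ 2 * a * q := Nat.mul_le_mul_left _ (by omega)
          omega
        have := map_prodMk_le_of_past_future (μ := μ) hy n (a - l)
          (g := fun x (i : Fin (q + 1)) (j : Fin (a + l)) => x ⟨s + 2 * a * i + j, hidx i j⟩)
          (by fun_prop) (h := fun x (j : Fin (a + l)) => x j) (by fun_prop) hB'
        rw [hn'] at this
        exact this
    rw [hsplit, hpi]
    refine hstep.trans ?_
    rw [Measure.prod_apply hB', Measure.prod_apply hB']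
    have hslice : ∫⁻ x, (μ.map (blocks y a l m s)) (Prod.mk x ⁻¹' (e.symm ⁻¹' B)) ∂P
        ≤ ∫⁻ x, (Measure.pi fun _ => P) (Prod.mk x ⁻¹' (e.symm ⁻¹' B)) ∂P
          + ENNReal.ofReal (m * betaCoeff μ y (a - l)) := by
      calc _ ≤ ∫⁻ x, ((Measure.pi fun _ => P) (Prod.mk x ⁻¹' (e.symm ⁻¹' B))
            + ENNReal.ofReal (m * betaCoeff μ y (a - l))) ∂P :=
            lintegral_mono fun x => ih (measurable_prodMk_left hB')
        _ = _ := by rw [lintegral_add_right _ measurable_const]; simp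
    refine (add_le_add_left hslice _).trans (le_of_eq ?_)
    rw [add_assoc, ← ENNReal.ofReal_add (by positivity) hβ]
    congr 2
    push_cast
    ring

end Mixing

/-! ### The SPO loss -/

section Loss

variable {d l : ℕ} {S Y : Set (Vec d)} {wstar : Vec d → Vec d}

/-- Since the oracle minimizes every linear functional, `w*(-y)` maximizes `w ↦ yᵀ w`. -/
lemma IsOracle.gapAt_eq (hw : IsOracle S wstar) (v : Vec d) :
    gapAt S v = inner ℝ v (wstar (-v)) - inner ℝ v (wstar v) := by
  have h1 : IsGreatest ((fun w => inner ℝ v w) '' S) (inner ℝ v (wstar (-v))) := by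
    refine ⟨⟨_, (hw (-v)).1, rfl⟩, ?_⟩
    rintro _ ⟨w, hwS, rfl⟩
    have := (hw (-v)).2 w hwS
    rw [inner_neg_left, inner_neg_left] at this
    simpa using this
  have h2 : IsLeast ((fun w => inner ℝ v w) '' S) (inner ℝ v (wstar v)) := by
    refine ⟨⟨_, (hw v).1, rfl⟩, ?_⟩
    rintro _ ⟨w, hwS, rfl⟩
    exact (hw v).2 w hwS
  rw [gapAt, h1.csSup_eq, h2.csInf_eq]

lemma IsOracle.gapAt_nonneg (hw : IsOracle S wstar) (v : Vec d) : 0 ≤ gapAt S v := by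
  rw [hw.gapAt_eq]
  linarith [(hw v).2 _ (hw (-v)).1]

lemma IsOracle.spoLoss_nonneg (hw : IsOracle S wstar) (u v : Vec d) : 0 ≤ spoLoss wstar u v := by
  rw [spoLoss]
  linarith [(hw v).2 _ (hw u).1]

lemma IsOracle.spoLoss_le_gapAt (hw : IsOracle S wstar) (u v : Vec d) :
    spoLoss wstar u v ≤ gapAt S v := by
  have := (hw (-v)).2 _ (hw u).1
  rw [inner_neg_left, inner_neg_left] at this
  rw [hw.gapAt_eq, spoLoss]
  linarith

lemma measurable_windowLoss (hw_meas : Measurable wstar) {f : (Fin l → Vec d) → Vec d}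
    (hf : Measurable f) : Measurable (windowLoss wstar f) := by
  unfold windowLoss spoLoss
  fun_prop

lemma IsOracle.measurable_gapAt (hw : IsOracle S wstar) (hw_meas : Measurable wstar) :
    Measurable (gapAt S) := by
  rw [funext hw.gapAt_eq]
  fun_prop

open Classical in
/-- The SPO loss on a window, replaced by `0` if the gap at the target exceeds `ω_S(𝔜)`. It takes
values in `[0, ω_S(𝔜)]` everywhere and agrees almost surely with the SPO loss. -/
noncomputable def truncLoss (S Y : Set (Vec d)) (wstar : Vec d → Vec d) (f : (Fin l → Vec d) → Vec d)
    (z : Window d l) : ℝ :=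
  if gapAt S z.2 ≤ gap S Y then windowLoss wstar f z else 0

lemma truncLoss_eq {f : (Fin l → Vec d) → Vec d} {z : Window d l} (hz : gapAt S z.2 ≤ gap S Y) :
    truncLoss S Y wstar f z = windowLoss wstar f z := if_pos hz

lemma ae_pi_forall_gapAt_le {ν : Measure (Window d l)} [IsProbabilityMeasure ν]
    (hν : ∀ᵐ z ∂ν, gapAt S z.2 ≤ gap S Y) (k : ℕ) :
    ∀ᵐ z ∂(Measure.pi fun _ : Fin k => ν), ∀ i, gapAt S (z i).2 ≤ gap S Y := by
  rw [ae_all_iff]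
  exact fun i => (measurePreserving_eval (fun _ : Fin k => ν) i).quasiMeasurePreserving.ae hν

/-- The truncated SPO losses of the predictors in `H` form a bounded loss class. -/
lemma IsMeasurableClass.boundedLossClass (hw : IsOracle S wstar) (hw_meas : Measurable wstar)
    {H : Set ((Fin l → Vec d) → Vec d)} (hH : ∀ f ∈ H, Measurable f)
    {ν : Measure (Window d l)} [IsProbabilityMeasure ν] (hcl : IsMeasurableClass wstar H ν)
    (hν : ∀ᵐ z ∂ν, gapAt S z.2 ≤ gap S Y) (h0 : 0 ≤ gap S Y) :
    BoundedLossClass ν (fun f : H => truncLoss S Y wstar f.1) (gap S Y) where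
  nonneg f z := by
    unfold truncLoss
    split_ifs
    · exact hw.spoLoss_nonneg _ _
    · exact le_rfl
  le f z := by
    unfold truncLoss
    split_ifs with h
    · exact (hw.spoLoss_le_gapAt _ _).trans h
    · exact h0
  measurable f := Measurable.ite
    (measurableSet_le ((hw.measurable_gapAt hw_meas).comp measurable_snd) measurable_const)
    (measurable_windowLoss hw_meas (hH f f.2)) measurable_const
  aemeasurable_iSup k b := by
    refine (hcl k b).congr ?_
    filter_upwards [ae_pi_forall_gapAt_le hν k] with z hz
    simp only [truncLoss_eq (hz _)]

lemma rademacher_truncLoss {H : Set ((Fin l → Vec d) → Vec d)} {m : ℕ} {z : Fin m → Window d l}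
    (hz : ∀ i, gapAt S (z i).2 ≤ gap S Y) :
    rademacher (fun f : H => truncLoss S Y wstar f.1) z = empRademacher wstar H z := by
  simp only [rademacher, empRademacher, supComb, truncLoss_eq (hz _), Finset.mul_sum, mul_assoc]

lemma integral_rademacher_truncLoss {H : Set ((Fin l → Vec d) → Vec d)}
    {ν : Measure (Window d l)} [IsProbabilityMeasure ν]
    (hν : ∀ᵐ z ∂ν, gapAt S z.2 ≤ gap S Y) (m : ℕ) :
    ∫ z : Fin m → Window d l, rademacher (fun f : H => truncLoss S Y wstar f.1) z
      ∂(Measure.pi fun _ => ν) = iidRademacher wstar H ν m :=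
  integral_congr_ae ((ae_pi_forall_gapAt_le hν m).mono fun _ hz => rademacher_truncLoss hz)

end Loss

/-! ### Risk and empirical risk -/

section Risk

lemma sum_range_mul_eq (g : ℕ → ℝ) (p m : ℕ) :
    ∑ s ∈ Finset.range (m * p), g s
      = ∑ i ∈ Finset.range m, ∑ r ∈ Finset.range p, g (p * i + r) := by
  induction m with
  | zero => simp
  | succ m ih => rw [add_one_mul, Finset.sum_range_add, ih, Finset.sum_range_succ, mul_comm m p]

variable {Ω : Type*} {d l : ℕ} {S Y : Set (Vec d)} {wstar : Vec d → Vec d} {y : ℕ → Ω → Vec d}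

/-- The empirical risk is the mean of the averages over the windows that start in the blocks with
even and with odd numbers. -/
lemma empRisk_eq (wstar : Vec d → Vec d) (f : (Fin l → Vec d) → Vec d) {n m a : ℕ} (hm : 0 < m)
    (ha : 0 < a) (hn : 2 * m * a + l = n) (ω : Ω) :
    empRisk y wstar l n f ω =
      1 / 2 * (1 / (a : ℝ) * ∑ r : Fin a, 1 / (m : ℝ)
          * ∑ i, windowLoss wstar f (blockWindow r (blocks y a l m 0 ω i)))
      + 1 / 2 * (1 / (a : ℝ) * ∑ r : Fin a, 1 / (m : ℝ)
          * ∑ i, windowLoss wstar f (blockWindow r (blocks y a l m a ω i))) := by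
  have hm' : (m : ℝ) ≠ 0 := by positivity
  have ha' : (a : ℝ) ≠ 0 := by positivity
  have hn' : n - l = m * (2 * a) := by rw [← hn, Nat.add_sub_cancel]; ring
  have h : ∀ s, ∑ r : Fin a, 1 / (m : ℝ)
        * ∑ i, windowLoss wstar f (blockWindow r (blocks y a l m s ω i))
      = 1 / (m : ℝ) * ∑ i ∈ Finset.range m, ∑ r ∈ Finset.range a,
        windowLoss wstar f (windowAt y l (s + 2 * a * i + r) ω) := fun s => by
    simp only [blocks, blockWindow_blockAt]
    rw [← Finset.mul_sum, Finset.sum_comm]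
    simp only [Finset.sum_range]
  rw [empRisk, hn', sum_range_mul_eq, h 0, h a]
  simp only [two_mul a, Finset.sum_range_add, Finset.sum_add_distrib]
  simp only [zero_add]
  rw [show ∑ i ∈ Finset.range m, ∑ r ∈ Finset.range a,
        windowLoss wstar f (windowAt y l ((a + a) * i + (a + r)) ω)
      = ∑ i ∈ Finset.range m, ∑ r ∈ Finset.range a,
        windowLoss wstar f (windowAt y l (a + (a + a) * i + r) ω) from
    Finset.sum_congr rfl fun i _ => Finset.sum_congr rfl fun r _ => by
      rw [← add_assoc, add_comm _ a]]
  push_cast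
  field_simp
  ring

variable [MeasurableSpace Ω] {μ : Measure Ω}

lemma IsStationary.risk_eq (hstat : IsStationary μ y) (hy : ∀ i, Measurable (y i))
    (hw_meas : Measurable wstar) {f : (Fin l → Vec d) → Vec d} (hf : Measurable f) (n : ℕ) :
    risk μ y wstar l n f = ∫ z, windowLoss wstar f z ∂(windowLaw μ y l) := by
  rw [risk, ← hstat.map_windowAt hy l (n - l - 1), integral_map
    (measurable_windowAt hy _ _).aemeasurable
    (measurable_windowLoss hw_meas hf).aestronglyMeasurable]

lemma exists_measurableSet_of_one_le {δ : ℝ} (hδ : 1 ≤ δ) (p : Ω → Prop) :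
    ∃ A : Set Ω, MeasurableSet A ∧ ENNReal.ofReal (1 - δ) ≤ μ A ∧ ∀ ω ∈ A, p ω :=
  ⟨∅, MeasurableSet.empty, by simp [hδ], fun _ h => h.elim⟩

lemma ae_windowLaw_gapAt_le (hw : IsOracle S wstar) (hw_meas : Measurable wstar)
    (hY : BddAbove (gapAt S '' Y)) (hy : ∀ i, Measurable (y i))
    (hyY : ∀ i, ∀ᵐ ω ∂μ, y i ω ∈ Y) (l : ℕ) :
    ∀ᵐ z ∂(windowLaw μ y l), gapAt S z.2 ≤ gap S Y := by
  have hset : MeasurableSet {z : Window d l | gapAt S z.2 ≤ gap S Y} :=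
    measurableSet_le ((hw.measurable_gapAt hw_meas).comp measurable_snd) measurable_const
  rw [windowLaw, ae_map_iff (measurable_windowAt hy l 0).aemeasurable hset]
  filter_upwards [hyY (0 + l)] with ω hω
  exact le_csSup hY ⟨_, hω, rfl⟩

variable [IsProbabilityMeasure μ]

lemma isProbabilityMeasure_windowLaw (hy : ∀ i, Measurable (y i)) (l : ℕ) :
    IsProbabilityMeasure (windowLaw μ y l) :=
  Measure.isProbabilityMeasure_map (measurable_windowAt hy l 0).aemeasurable

lemma gap_nonneg (hw : IsOracle S wstar) (hY : BddAbove (gapAt S '' Y))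
    (hyY : ∀ i, ∀ᵐ ω ∂μ, y i ω ∈ Y) : 0 ≤ gap S Y := by
  obtain ⟨ω, hω⟩ := (hyY 0).exists
  exact (hw.gapAt_nonneg _).trans (le_csSup hY ⟨_, hω, rfl⟩)

/-- The uniform deviation bound for the SPO risk, outside of a small set of configurations of the
blocks, to be avoided by both sequences of alternate blocks. The smallness refers to independent
blocks. -/
theorem exists_measurableSet_risk_le (hw : IsOracle S wstar) (hw_meas : Measurable wstar)
    (hY : BddAbove (gapAt S '' Y)) (hy : ∀ i, Measurable (y i)) (hyY : ∀ i, ∀ᵐ ω ∂μ, y i ω ∈ Y)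
    (hstat : IsStationary μ y) {n m a : ℕ} (hm : 0 < m) (ha : 0 < a) (hn : 2 * m * a + l = n)
    {H : Set ((Fin l → Vec d) → Vec d)} (hne : H.Nonempty) (hH : ∀ f ∈ H, Measurable f)
    (hcl : IsMeasurableClass wstar H (windowLaw μ y l)) {δ : ℝ} (hδ : 0 < δ) (hδ1 : δ ≤ 1) :
    ∃ B : Set (Fin m → Fin (a + l) → Vec d), MeasurableSet B ∧
      (Measure.pi fun _ => μ.map (blockAt y (a + l) 0)) B ≤ ENNReal.ofReal δ ∧
      ∀ ω, blocks y a l m 0 ω ∉ B → blocks y a l m a ω ∉ B → ∀ f ∈ H,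
        risk μ y wstar l n f ≤ empRisk y wstar l n f ω
          + 2 * iidRademacher wstar H (windowLaw μ y l) m
          + gap S Y * √(Real.log (1 / δ) / (2 * m)) := by
  have := isProbabilityMeasure_windowLaw (μ := μ) hy l
  have := Measure.isProbabilityMeasure_map (μ := μ) (measurable_blockAt hy (a + l) 0).aemeasurable
  have := hne.to_subtype
  have hν := ae_windowLaw_gapAt_le (μ := μ) hw hw_meas hY hy hyY l
  have h0 := gap_nonneg (μ := μ) hw hY hyY
  obtain ⟨B, hB, hPB, hdev⟩ :=
    (hcl.boundedLossClass hw hw_meas hH hν h0).exists_measurableSet_uniform_deviation_blocks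
      (μ.map (blockAt y (a + l) 0)) hm ha h0
      (fun r : Fin a => hstat.measurePreserving_blockWindow hy r) hδ hδ1
  rw [integral_rademacher_truncLoss hν m] at hdev
  -- the configurations on which the truncation has an effect form a null set
  have hN : ∀ᵐ b ∂(Measure.pi fun _ : Fin m => μ.map (blockAt y (a + l) 0)), ∀ (i : Fin m)
      (r : Fin a), gapAt S (blockWindow r (b i)).2 ≤ gap S Y := by
    simp only [ae_all_iff]
    exact fun i r => ((hstat.measurePreserving_blockWindow hy r).comp
      (measurePreserving_eval _ i)).quasiMeasurePreserving.ae hν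
  refine ⟨toMeasurable (Measure.pi fun _ : Fin m => μ.map (blockAt y (a + l) 0))
    (B ∪ {b | ¬ ∀ (i : Fin m) (r : Fin a),
    gapAt S (blockWindow r (b i)).2 ≤ gap S Y}), measurableSet_toMeasurable _ _, ?_, ?_⟩
  · rw [measure_toMeasurable]
    refine (measure_union_le _ _).trans ?_
    rw [ae_iff.1 hN, add_zero]
    exact hPB
  · intro ω hω0 hωa f hf
    have hgood : ∀ s, blocks y a l m s ω ∉ toMeasurable
        (Measure.pi fun _ : Fin m => μ.map (blockAt y (a + l) 0))
        (B ∪ {b | ¬ ∀ (i : Fin m) (r : Fin a),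
          gapAt S (blockWindow r (b i)).2 ≤ gap S Y}) →
        risk μ y wstar l n f ≤ 1 / (a : ℝ) * ∑ r : Fin a, 1 / (m : ℝ)
          * ∑ i, windowLoss wstar f (blockWindow r (blocks y a l m s ω i))
          + 2 * iidRademacher wstar H (windowLaw μ y l) m
          + gap S Y * √(Real.log (1 / δ) / (2 * m)) := by
      intro s hs
      have hs' := fun hh => hs (subset_toMeasurable _ _ hh)
      have h1 := hdev _ (fun hh => hs' (Or.inl hh)) ⟨f, hf⟩
      have h2 := not_not.1 fun hh => hs' (Or.inr (Set.mem_ofPred.2 hh))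
      simp only [truncLoss_eq (h2 _ _)] at h1
      rwa [integral_congr_ae (hν.mono fun z hz => truncLoss_eq hz),
        ← hstat.risk_eq hy hw_meas (hH f hf) n] at h1
    rw [empRisk_eq wstar f hm ha hn ω]
    linarith [hgood 0 hω0, hgood a hωa]

/-- The lower tail of the empirical Rademacher complexity of independent windows. -/
theorem exists_measurableSet_iidRademacher_le (hw : IsOracle S wstar) (hw_meas : Measurable wstar)
    (hY : BddAbove (gapAt S '' Y)) (hy : ∀ i, Measurable (y i)) (hyY : ∀ i, ∀ᵐ ω ∂μ, y i ω ∈ Y)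
    {m : ℕ} (hm : 0 < m) {H : Set ((Fin l → Vec d) → Vec d)} (hne : H.Nonempty)
    (hH : ∀ f ∈ H, Measurable f) (hcl : IsMeasurableClass wstar H (windowLaw μ y l))
    {δ : ℝ} (hδ : 0 < δ) (hδ1 : δ ≤ 1) :
    ∃ B : Set (Fin m → Window d l), MeasurableSet B ∧
      iidLaw (windowLaw μ y l) m B ≤ ENNReal.ofReal δ ∧
      ∀ z ∉ B, iidRademacher wstar H (windowLaw μ y l) m
        ≤ empRademacher wstar H z + gap S Y * √(Real.log (1 / δ) / (2 * m)) := by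
  have := isProbabilityMeasure_windowLaw (μ := μ) hy l
  have := hne.to_subtype
  have hν := ae_windowLaw_gapAt_le (μ := μ) hw hw_meas hY hy hyY l
  have h0 := gap_nonneg (μ := μ) hw hY hyY
  obtain ⟨B, hB, hPB, hdev⟩ :=
    (hcl.boundedLossClass hw hw_meas hH hν h0).exists_measurableSet_integral_rademacher_le
      hm h0 hδ hδ1
  rw [integral_rademacher_truncLoss hν m] at hdev
  refine ⟨toMeasurable (iidLaw (windowLaw μ y l) m)
    (B ∪ {z | ¬ ∀ i, gapAt S (z i).2 ≤ gap S Y}), measurableSet_toMeasurable _ _, ?_, ?_⟩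
  · rw [measure_toMeasurable]
    refine (measure_union_le _ _).trans ?_
    rw [iidLaw, ae_iff.1 (ae_pi_forall_gapAt_le hν m), add_zero]
    exact hPB
  · intro z hz
    have hz' := fun hh => hz (subset_toMeasurable _ _ hh)
    have h1 := hdev z fun hh => hz' (Or.inl hh)
    rwa [rademacher_truncLoss (not_not.1 fun hh => hz' (Or.inr (Set.mem_ofPred.2 hh)))] at h1

/-- An event outside of a set of outer measure at most `δ` has probability at least `1 - δ`. -/
lemma exists_measurableSet_of_measure_le {E : Set Ω} {δ : ℝ} (hδ : 0 ≤ δ)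
    (hE : μ E ≤ ENNReal.ofReal δ) {p : Ω → Prop} (hp : ∀ ω ∉ E, p ω) :
    ∃ A : Set Ω, MeasurableSet A ∧ ENNReal.ofReal (1 - δ) ≤ μ A ∧ ∀ ω ∈ A, p ω := by
  refine ⟨(toMeasurable μ E)ᶜ, (measurableSet_toMeasurable _ _).compl, ?_, fun ω hω =>
    hp ω fun h => hω (subset_toMeasurable _ _ h)⟩
  rw [prob_compl_eq_one_sub (measurableSet_toMeasurable _ _), measure_toMeasurable,
    ENNReal.ofReal_sub _ hδ, ENNReal.ofReal_one]
  exact tsub_le_tsub_left hE _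

/-- Transfer of an estimate from independent blocks to the blocks of the process. -/
lemma measure_blocks_mem_le (hy : ∀ i, Measurable (y i)) (hstat : IsStationary μ y) {a m : ℕ}
    (hla : l < a) (s : ℕ) {B : Set (Fin m → Fin (a + l) → Vec d)} (hB : MeasurableSet B) {δ : ℝ}
    (hδ : 0 ≤ δ)
    (hPB : (Measure.pi fun _ => μ.map (blockAt y (a + l) 0)) B ≤ ENNReal.ofReal δ) :
    μ (blocks y a l m s ⁻¹' B) ≤ ENNReal.ofReal (δ + m * betaCoeff μ y (a - l)) := by
  have hβ : 0 ≤ betaCoeff μ y (a - l) := ENNReal.toReal_nonneg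
  rw [← Measure.map_apply (measurable_blocks hy _ _ _ _) hB,
    ENNReal.ofReal_add hδ (by positivity)]
  exact (map_blocks_le hy hstat hla s m hB).trans (add_le_add_left hPB _)

end Risk

end SPO

theorem mainTheorem1 {Ω : Type*} [MeasurableSpace Ω] (μ : Measure Ω) [IsProbabilityMeasure μ]
    {d : ℕ}
    -- the feasible region, its optimization oracle, and the region of the cost vectors
    (S : Set (SPO.Vec d)) (wstar : SPO.Vec d → SPO.Vec d) (hw : SPO.IsOracle S wstar)
    (hw_meas : Measurable wstar)
    (Y : Set (SPO.Vec d)) (hY : BddAbove (SPO.gapAt S '' Y))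
    -- the data
    (y : ℕ → Ω → SPO.Vec d) (hy_meas : ∀ i, Measurable (y i)) (hyY : ∀ i, ∀ᵐ ω ∂μ, y i ω ∈ Y)
    (hstat : SPO.IsStationary μ y) (hmix : SPO.IsBetaMixing μ y)
    -- sample size, memory, blocks
    (n m a l : ℕ) (hm : 0 < m) (hl : 0 < l) (hla : l < a) (hn : 2 * m * a + l = n)
    -- the hypothesis class
    (H : Set ((Fin l → SPO.Vec d) → SPO.Vec d)) (hH : ∀ f ∈ H, Measurable f)
    (hH_class : SPO.IsMeasurableClass wstar H (SPO.windowLaw μ y l))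
    (δ₁ δ₂ : ℝ) (hδ₁ : 2 * m * SPO.betaCoeff μ y (a - l) < δ₁)
    (hδ₂ : 4 * m * SPO.betaCoeff μ y (a - l) < δ₂) :
    -- the bound through the Rademacher complexity of `m` independent windows
    (∃ A : Set Ω, MeasurableSet A ∧ ENNReal.ofReal (1 - δ₁) ≤ μ A ∧ ∀ ω ∈ A, ∀ f ∈ H,
      SPO.risk μ y wstar l n f ≤ SPO.empRisk y wstar l n f ω
        + 2 * SPO.iidRademacher wstar H (SPO.windowLaw μ y l) m
        + SPO.gap S Y *
          √(Real.log (2 / (δ₁ - 2 * m * SPO.betaCoeff μ y (a - l))) / (2 * m))) ∧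
    -- the bound through the empirical Rademacher complexity of an i.i.d. sample of `m` windows
    (∀ Ytilde : Ω → Fin m → SPO.Window d l,
      HasLaw Ytilde (SPO.iidLaw (SPO.windowLaw μ y l) m) μ →
      ∃ A : Set Ω, MeasurableSet A ∧ ENNReal.ofReal (1 - δ₂) ≤ μ A ∧ ∀ ω ∈ A, ∀ f ∈ H,
        SPO.risk μ y wstar l n f ≤ SPO.empRisk y wstar l n f ω
          + 2 * SPO.empRademacher wstar H (Ytilde ω)
          + 3 * SPO.gap S Y *
            √(Real.log (4 / (δ₂ - 2 * m * SPO.betaCoeff μ y (a - l))) / (2 * m))) ∧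
    -- the same bound with the windows at a fixed position `j` of every other block of the data
    (∀ j < a,
      ∃ A : Set Ω, MeasurableSet A ∧ ENNReal.ofReal (1 - δ₂) ≤ μ A ∧ ∀ ω ∈ A, ∀ f ∈ H,
        SPO.risk μ y wstar l n f ≤ SPO.empRisk y wstar l n f ω
          + 2 * SPO.empRademacher wstar H
              (fun i : Fin m => SPO.windowAt y l (2 * a * i + j) ω)
          + 3 * SPO.gap S Y *
            √(Real.log (4 / (δ₂ - 2 * m * SPO.betaCoeff μ y (a - l))) / (2 * m))) := by
  have hβ : 0 ≤ SPO.betaCoeff μ y (a - l) := ENNReal.toReal_nonneg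
  have hmβ : 0 ≤ m * SPO.betaCoeff μ y (a - l) := by positivity
  have ha : 0 < a := by omega
  rcases H.eq_empty_or_nonempty with rfl | hne
  · refine ⟨⟨Set.univ, MeasurableSet.univ, ?_, by simp⟩,
      fun _ _ => ⟨Set.univ, MeasurableSet.univ, ?_, by simp⟩,
      fun _ _ => ⟨Set.univ, MeasurableSet.univ, ?_, by simp⟩⟩ <;>
    · rw [measure_univ, ENNReal.ofReal_le_one]
      linarith
  have := SPO.isProbabilityMeasure_windowLaw (μ := μ) hy_meas l
  have hunion : ∀ {E F : Set Ω} {u v : ℝ}, 0 ≤ u → 0 ≤ v → μ E ≤ ENNReal.ofReal u →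
      μ F ≤ ENNReal.ofReal v → μ (E ∪ F) ≤ ENNReal.ofReal (u + v) := fun hu hv hE hF => by
    rw [ENNReal.ofReal_add hu hv]
    exact (measure_union_le _ _).trans (add_le_add hE hF)
  refine ⟨?_, ?_⟩
  · set η := δ₁ - 2 * m * SPO.betaCoeff μ y (a - l) with hη
    have hη0 : 0 < η := by linarith
    rcases lt_or_ge 2 η with h2 | h2
    · exact SPO.exists_measurableSet_of_one_le (by linarith) _
    obtain ⟨B, hB, hPB, hrisk⟩ := SPO.exists_measurableSet_risk_le hw hw_meas hY hy_meas hyY hstat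
      hm ha hn hne hH hH_class (δ := η / 2) (by linarith) (by linarith)
    rw [one_div_div] at hrisk
    have h0 := SPO.measure_blocks_mem_le hy_meas hstat hla 0 hB (by linarith) hPB
    have h1 := SPO.measure_blocks_mem_le hy_meas hstat hla a hB (by linarith) hPB
    refine SPO.exists_measurableSet_of_measure_le (by linarith)
      ((hunion (by linarith) (by linarith) h0 h1).trans (ENNReal.ofReal_le_ofReal (by linarith)))
      fun ω hω => hrisk ω (fun h => hω (Or.inl h)) fun h => hω (Or.inr h)
  · set η := δ₂ - 2 * m * SPO.betaCoeff μ y (a - l) with hη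
    have hη0 : 0 < η := by linarith
    rcases lt_or_ge 4 η with h4 | h4
    · exact ⟨fun _ _ => SPO.exists_measurableSet_of_one_le (by linarith) _,
        fun _ _ => SPO.exists_measurableSet_of_one_le (by linarith) _⟩
    obtain ⟨B, hB, hPB, hrisk⟩ := SPO.exists_measurableSet_risk_le hw hw_meas hY hy_meas hyY hstat
      hm ha hn hne hH hH_class (δ := η / 4) (by linarith) (by linarith)
    obtain ⟨C, hC, hPC, hrad⟩ := SPO.exists_measurableSet_iidRademacher_le hw hw_meas hY hy_meas hyY
      hm hne hH hH_class (δ := η / 4) (by linarith) (by linarith)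
    rw [one_div_div] at hrisk hrad
    have h1 := SPO.measure_blocks_mem_le hy_meas hstat hla a hB (by linarith) hPB
    refine ⟨fun Ytilde hlaw => ?_, fun j hj => ?_⟩
    · have h0 := SPO.measure_blocks_mem_le hy_meas hstat hla 0 hB (by linarith) hPB
      have hYt : μ (Ytilde ⁻¹' C) ≤ ENNReal.ofReal (η / 4) := by
        rw [← Measure.map_apply_of_aemeasurable hlaw.aemeasurable hC, hlaw.map_eq]
        exact hPC
      refine SPO.exists_measurableSet_of_measure_le (by linarith)
        ((hunion (by linarith) (by linarith) (hunion (by linarith) (by linarith) h0 h1) hYt).trans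
          (ENNReal.ofReal_le_ofReal (by linarith))) fun ω hω f hf => ?_
      linarith [hrisk ω (fun h => hω (Or.inl (Or.inl h))) (fun h => hω (Or.inl (Or.inr h))) f hf,
        hrad (Ytilde ω) fun h => hω (Or.inr h)]
    · -- The windows at position `j` are functions of the even-numbered blocks. Both estimates for
      -- these blocks are transferred together, so that the mixing error is counted once for them.
      have := Measure.isProbabilityMeasure_map (μ := μ)
        (SPO.measurable_blockAt hy_meas (a + l) 0).aemeasurable
      have hpos := measurePreserving_pi (fun _ : Fin m => μ.map (SPO.blockAt y (a + l) 0))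
        (fun _ => SPO.windowLaw μ y l)
        fun _ => hstat.measurePreserving_blockWindow hy_meas (⟨j, hj⟩ : Fin a)
      set C' : Set (Fin m → Fin (a + l) → SPO.Vec d) :=
        (fun b i => SPO.blockWindow (⟨j, hj⟩ : Fin a) (b i)) ⁻¹' C with hC'
      have hPC' : (Measure.pi fun _ => μ.map (SPO.blockAt y (a + l) 0)) C'
          ≤ ENNReal.ofReal (η / 4) :=
        (hpos.measure_preimage hC.nullMeasurableSet).trans_le hPC
      have hPBC : (Measure.pi fun _ => μ.map (SPO.blockAt y (a + l) 0)) (B ∪ C')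
          ≤ ENNReal.ofReal (η / 4 + η / 4) := by
        rw [ENNReal.ofReal_add (by linarith) (by linarith)]
        exact (measure_union_le _ _).trans (add_le_add hPB hPC')
      have h0 := SPO.measure_blocks_mem_le hy_meas hstat hla 0 (hB.union (hpos.measurable hC))
        (by linarith) hPBC
      refine SPO.exists_measurableSet_of_measure_le (by linarith)
        ((hunion (by linarith) (by linarith) h0 h1).trans
          (ENNReal.ofReal_le_ofReal (by linarith))) fun ω hω f hf => ?_
      have hz : (fun i => SPO.blockWindow (⟨j, hj⟩ : Fin a) (SPO.blocks y a l m 0 ω i))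
          = fun i : Fin m => SPO.windowAt y l (2 * a * i + j) ω := by
        ext1 i
        rw [SPO.blocks, SPO.blockWindow_blockAt, zero_add]
      rw [← hz]
      linarith [hrisk ω (fun h => hω (Or.inl (Or.inl h))) (fun h => hω (Or.inr h)) f hf,
        hrad (fun i => SPO.blockWindow (⟨j, hj⟩ : Fin a) (SPO.blocks y a l m 0 ω i))
          fun h => hω (Or.inl (Or.inr h))]
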